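/- Let $\mathbb K$ be $\mathbb R$ or $\mathbb C$. For Banach spaces $(E_i)_{i\in I}$ over $\mathbb K$ and $1\le p<\infty$ let $(\oplus_i E_i)_{\ell^p}$ be their direct $\ell^p$-sum; for $p=\infty$ the same notation denotes their direct $c_0$-sum, i.e. the space of families $(x_i)$ such that $\{i:\|x_i\|>\alpha\}$ is finite for every $\alpha>0$, with the supremum norm. For a Banach space $X$ let $\mathcal K(X)$ be the space of compact operators on $X$, let $\mathcal A(X)$ be the operator-norm closure of the bounded finite rank operators on $X$, and equip the quotient algebra $\mathcal K(X)/\mathcal A(X)$ with the quotient norm. Let $d_{BM}(E,F)=\inf\{\|T\|\,\|T^{-1}\|: T\colon E\to F \text{ a linear isomorphism}\}$ denote the Banach–Mazur distance. Theorem. There is an uncountable set $\Gamma$ such that the following holds. Let $(E_n)_{n\in\mathbb N}$ be any sequence of finite-dimensional normed spaces over $\mathbb K$ that is dense, with respect to $d_{BM}$, in the class of all (nonzero) finite-dimensional normed spaces, i.e. for every such $F$ and every $\delta>1$ there is $n$ with $d_{BM}(E_n,F)<\delta$; let $(G_m)_{m\in\mathbb N}$ be any listing of the spaces $E_n$ in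 which each $E_n$ is repeated infinitely often; and let $1\le p\le\infty$. Let $C_p=(\oplus_{m\in\mathbb N}G_m)_{\ell^p}$ be Johnson's space, and let $$Z=Z^p_{FJ}=\big(\oplus_W W\big)_{\ell^p},$$ where $W$ runs through all closed infinite-dimensional subspaces of $C_p$, be the Figiel–Johnson universal compact factorisation space. Then $c_0(\Gamma)$ is linearly isomorphic to a subspace of $\mathcal K(Z)/\mathcal A(Z)$: there are a bounded linear map $\Phi\colon c_0(\Gamma)\to\mathcal K(Z)/\mathcal A(Z)$ and a constant $c>0$ with $\|\Phi(a)\|\ge c\|a\|_\infty$ for all $a\in c_0(\Gamma)$. In particular, $\mathcal K(Z)/\mathcal A(Z)$ is non-separable. -/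

import Mathlib

open scoped ENNReal Topology

universe u v

section DirectSums

variable (𝕜 : Type*) [RCLike 𝕜] {ι : Type*} (E : ι → Type*)
  [∀ i, NormedAddCommGroup (E i)] [∀ i, NormedSpace 𝕜 (E i)]

/-- The direct `ℓ^p`-sum of the spaces `E i`, with the convention that for `p = ∞` it is the
`c₀`-sum: the bounded families whose norms tend to zero along the cofinite filter, with the
supremum norm. -/
def lpDirectSum (p : ℝ≥0∞) [Fact (1 ≤ p)] : Submodule 𝕜 (lp E p) where
  carrier := {x | p = ∞ → Filter.Tendsto (fun i => ‖x i‖) Filter.cofinite (𝓝 0)}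
  zero_mem' := fun _ => by
    simpa using (tendsto_const_nhds : Filter.Tendsto (fun _ : ι => (0 : ℝ)) Filter.cofinite (𝓝 0))
  add_mem' := by
    intro x y hx hy hp
    refine squeeze_zero (fun i => norm_nonneg _) (fun i => ?_)
      (by simpa using (hx hp).add (hy hp))
    exact norm_add_le (x i) (y i)
  smul_mem' := by
    intro c x hx hp
    have h := (hx hp).const_mul ‖c‖
    simpa [norm_smul] using h

/-- The space `c₀(Γ)` with the supremum norm. -/
abbrev cZero (Γ : Type*) : Submodule 𝕜 (lp (fun _ : Γ => 𝕜) ∞) :=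
  lpDirectSum 𝕜 (fun _ : Γ => 𝕜) ∞

end DirectSums

section Operators

variable (𝕜 : Type*) [RCLike 𝕜] (X Y : Type*) [NormedAddCommGroup X] [NormedSpace 𝕜 X]
  [NormedAddCommGroup Y] [NormedSpace 𝕜 Y]

/-- The bounded finite rank operators `X → Y`. -/
def finiteRankOperators : Submodule 𝕜 (X →L[𝕜] Y) where
  carrier := {T | FiniteDimensional 𝕜 (LinearMap.range (T : X →ₗ[𝕜] Y))}
  zero_mem' := by
    change FiniteDimensional 𝕜 (LinearMap.range ((0 : X →L[𝕜] Y) : X →ₗ[𝕜] Y))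
    rw [ContinuousLinearMap.toLinearMap_zero, LinearMap.range_zero]
    infer_instance
  add_mem' := by
    intro S T hS hT
    have hS' : FiniteDimensional 𝕜 (LinearMap.range (S : X →ₗ[𝕜] Y)) := hS
    have hT' : FiniteDimensional 𝕜 (LinearMap.range (T : X →ₗ[𝕜] Y)) := hT
    exact Submodule.finiteDimensional_of_le
      (LinearMap.range_add_le (S : X →ₗ[𝕜] Y) (T : X →ₗ[𝕜] Y))
  smul_mem' := by
    intro c T hT
    have hT' : FiniteDimensional 𝕜 (LinearMap.range (T : X →ₗ[𝕜] Y)) := hT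
    refine Submodule.finiteDimensional_of_le (S₂ := LinearMap.range (T : X →ₗ[𝕜] Y)) ?_
    rintro _ ⟨x, rfl⟩
    exact ⟨c • x, by simp⟩

/-- The approximable operators `X → Y`: the operator norm closure of the finite rank operators. -/
def approximableOperators : Submodule 𝕜 (X →L[𝕜] Y) :=
  (finiteRankOperators 𝕜 X Y).topologicalClosure

/-- The compact operators `X → Y`, with the operator norm. -/
abbrev compactOperators : Submodule 𝕜 (X →L[𝕜] Y) :=
  compactOperator (RingHom.id 𝕜) X Y

/-- For a Banach space `X`, the quotient `𝔄_X = K(X) / A(X)` of the compact operators by the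
approximable operators. -/
def CompactByApproximable : Type _ :=
  compactOperators 𝕜 X X ⧸
    (approximableOperators 𝕜 X X).submoduleOf (compactOperators 𝕜 X X)

instance isClosed_approximableOperators_submoduleOf :
    IsClosed ((approximableOperators 𝕜 X X).submoduleOf (compactOperators 𝕜 X X) :
      Set (compactOperators 𝕜 X X)) :=
  (finiteRankOperators 𝕜 X X).isClosed_topologicalClosure.preimage continuous_subtype_val

/-- The quotient norm `‖T + A(X)‖ = inf {‖T - S‖ : S ∈ A(X)}`. -/
noncomputable instance : NormedAddCommGroup (CompactByApproximable 𝕜 X) :=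
  inferInstanceAs (NormedAddCommGroup (compactOperators 𝕜 X X ⧸
    (approximableOperators 𝕜 X X).submoduleOf (compactOperators 𝕜 X X)))

noncomputable instance : NormedSpace 𝕜 (CompactByApproximable 𝕜 X) :=
  inferInstanceAs (NormedSpace 𝕜 (compactOperators 𝕜 X X ⧸
    (approximableOperators 𝕜 X X).submoduleOf (compactOperators 𝕜 X X)))

/-- Approximable operators into a Banach space are compact, so that `A(X)` really is a subspace
of `K(X)`. -/
theorem approximableOperators_le_compactOperators [CompleteSpace Y] :
    approximableOperators 𝕜 X Y ≤ compactOperators 𝕜 X Y := by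
  have h : IsClosed (compactOperators 𝕜 X Y : Set (X →L[𝕜] Y)) :=
    isClosed_setOfPred_isCompactOperator
  refine Submodule.topologicalClosure_minimal _ (fun T hT => ?_) h
  have hT' : FiniteDimensional 𝕜 (LinearMap.range (T : X →ₗ[𝕜] Y)) := hT
  have : ProperSpace (LinearMap.range (T : X →ₗ[𝕜] Y)) := FiniteDimensional.proper_rclike 𝕜 _
  let R : X →L[𝕜] LinearMap.range (T : X →ₗ[𝕜] Y) :=
    T.codRestrict (LinearMap.range (T : X →ₗ[𝕜] Y)) (fun x => ⟨x, rfl⟩)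
  have hR : IsCompactOperator R := isCompactOperator_of_locallyCompactSpace_dom R
  exact hR.clm_comp (LinearMap.range (T : X →ₗ[𝕜] Y)).subtypeL

/-- `X` embeds into `Y` as a linear isomorphic subspace: there is a bounded linear map `X → Y`
which is bounded below. -/
def IsomorphicallyEmbeds : Prop :=
  ∃ Φ : X →L[𝕜] Y, ∃ c : ℝ, 0 < c ∧ ∀ x : X, c * ‖x‖ ≤ ‖Φ x‖

end Operators

section UniversalSpaces

/-- The Banach–Mazur distance `inf ‖T‖ ‖T⁻¹‖` over all linear isomorphisms `T : E → F`
(it is `∞` if there are none). -/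
noncomputable def banachMazurDist (𝕜 : Type*) [RCLike 𝕜] (E F : Type*)
    [NormedAddCommGroup E] [NormedSpace 𝕜 E] [NormedAddCommGroup F] [NormedSpace 𝕜 F] : ℝ≥0∞ :=
  ⨅ T : E ≃L[𝕜] F,
    ENNReal.ofReal (‖(T : E →L[𝕜] F)‖ * ‖(T.symm : F →L[𝕜] E)‖)

/-- The sequence `E` is dense, for the Banach–Mazur distance, in the class of all (nonzero)
finite-dimensional normed spaces over `𝕜`. Every such space is isometric to one whose
underlying type is in the universe of `𝕜`. -/
def IsBanachMazurDense (𝕜 : Type u) [RCLike 𝕜] (E : ℕ → Type v)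
    [∀ n, NormedAddCommGroup (E n)] [∀ n, NormedSpace 𝕜 (E n)] : Prop :=
  ∀ (F : Type u) [NormedAddCommGroup F] [NormedSpace 𝕜 F] [FiniteDimensional 𝕜 F] [Nontrivial F],
    ∀ δ : ℝ≥0∞, 1 < δ → ∃ n, banachMazurDist 𝕜 (E n) F < δ

variable (𝕜 : Type*) [RCLike 𝕜] (E : ℕ → Type*)
  [∀ n, NormedAddCommGroup (E n)] [∀ n, NormedSpace 𝕜 (E n)]

/-- Johnson's space `C_p = (⊕ₘ Gₘ)_{ℓ^p}`, where `G m = E (s m)` is a listing of the spaces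
`E n`. -/
def JohnsonSpace (s : ℕ → ℕ) (p : ℝ≥0∞) [Fact (1 ≤ p)] : Type _ :=
  lpDirectSum 𝕜 (fun m => E (s m)) p

noncomputable instance (s : ℕ → ℕ) (p : ℝ≥0∞) [Fact (1 ≤ p)] :
    NormedAddCommGroup (JohnsonSpace 𝕜 E s p) :=
  inferInstanceAs (NormedAddCommGroup (lpDirectSum 𝕜 (fun m => E (s m)) p))

noncomputable instance (s : ℕ → ℕ) (p : ℝ≥0∞) [Fact (1 ≤ p)] :
    NormedSpace 𝕜 (JohnsonSpace 𝕜 E s p) :=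
  inferInstanceAs (NormedSpace 𝕜 (lpDirectSum 𝕜 (fun m => E (s m)) p))

/-- The closed infinite-dimensional subspaces of a normed space. -/
abbrev ClosedInfDimSubspace (X : Type*) [NormedAddCommGroup X] [NormedSpace 𝕜 X] : Type _ :=
  {W : Submodule 𝕜 X // IsClosed (W : Set X) ∧ ¬ FiniteDimensional 𝕜 W}

/-- The Figiel–Johnson universal compact factorisation space `Z^p_FJ`: the direct `ℓ^p`-sum of
all closed infinite-dimensional subspaces of `C_p`. -/
def FigielJohnsonSpace (s : ℕ → ℕ) (p : ℝ≥0∞) [Fact (1 ≤ p)] : Type _ :=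
  lpDirectSum 𝕜 (fun W : ClosedInfDimSubspace 𝕜 (JohnsonSpace 𝕜 E s p) => W.1) p

noncomputable instance (s : ℕ → ℕ) (p : ℝ≥0∞) [Fact (1 ≤ p)] :
    NormedAddCommGroup (FigielJohnsonSpace 𝕜 E s p) :=
  inferInstanceAs (NormedAddCommGroup
    (lpDirectSum 𝕜 (fun W : ClosedInfDimSubspace 𝕜 (JohnsonSpace 𝕜 E s p) => W.1) p))

noncomputable instance (s : ℕ → ℕ) (p : ℝ≥0∞) [Fact (1 ≤ p)] :
    NormedSpace 𝕜 (FigielJohnsonSpace 𝕜 E s p) :=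
  inferInstanceAs (NormedSpace 𝕜
    (lpDirectSum 𝕜 (fun W : ClosedInfDimSubspace 𝕜 (JohnsonSpace 𝕜 E s p) => W.1) p))

end UniversalSpaces

/-!
Johnson's space contains, uniformly complemented, the spaces `ℓ_∞(Ω n)` for any sequence of finite
sets `Ω n`. Davie's random Walsh functions on suitable `Ω n` give vectors, each living on two
consecutive blocks, whose closed linear span `W` lacks the approximation property. Rescaling the
blocks by a summable sequence gives a second such subspace `V` and a compact operator `T : V → W`,
which maps the vectors spanning `V` to those spanning `W`. The averages over the `n`-th level of
the diagonal coefficients of an operator `V → W` converge as `n → ∞`, because by randomness the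
averaged kernels of consecutive levels almost agree. The limit is a bounded functional which
vanishes on rank one operators and is `1` at `T`, so `T` is not approximable.

Restricting and corestricting `T` to uncountably many pairs of hyperplanes of `V` and `W` changes
it only by finite rank operators, so it gives compact operators `R t`, bounded by `3` and at
distance at least `1` from the approximable ones after normalisation, between pairwise distinct
summands of `Z`. For `c ∈ c₀(ℝ)` the sum of `c t • R t` then has norm at most `3 * ‖c‖`, and its
distance to the approximable operators is at least `‖c t‖` for every `t`, as one sees by
compressing to the summands of `R t`.
-/

open scoped BigOperators

section RandomSigns

/-- The sign `(-1)^b`. -/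
def boolSign (b : Bool) : ℝ := if b then -1 else 1

theorem abs_boolSign (b : Bool) : |boolSign b| = 1 := by
  cases b <;> simp [boolSign]

theorem mul_self_of_abs_eq_one {x : ℝ} (hx : |x| = 1) : x * x = 1 := by
  rw [← abs_mul_abs_self, hx, one_mul]

variable {J : Type*} [Fintype J]

theorem expect_prod_apply [DecidableEq J] {A : Type*} [Fintype A] (f : J → A → ℝ) :
    𝔼 e : J → A, ∏ j, f j (e j) = ∏ j, 𝔼 a, f j a := by
  simp only [Fintype.expect_eq_sum_div_card, Finset.prod_div_distrib, Finset.prod_univ_sum,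
    Fintype.piFinset_univ, Finset.prod_const, Finset.card_univ, Fintype.card_fun, Nat.cast_pow]

theorem expect_bool (f : Bool → ℝ) : 𝔼 b, f b = (f true + f false) / 2 := by
  rw [Fintype.expect_eq_sum_div_card, Fintype.sum_bool, Fintype.card_bool, Nat.cast_ofNat]

theorem expect_exp_sum_boolSign_mul [DecidableEq J] (a : J → ℝ) :
    𝔼 e : J → Bool, Real.exp (∑ j, boolSign (e j) * a j) = ∏ j, Real.cosh (a j) := by
  have coordinate_mean (x : ℝ) : 𝔼 b, Real.exp (boolSign b * x) = Real.cosh x := by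
    rw [expect_bool, Real.cosh_eq, add_comm]
    simp [boolSign]
  simp only [Real.exp_sum, ← coordinate_mean]
  exact expect_prod_apply fun j b => Real.exp (boolSign b * a j)

theorem expect_exp_abs_sum_boolSign_mul_le [DecidableEq J] (a : J → ℝ) :
    𝔼 e : J → Bool, Real.exp |∑ j, boolSign (e j) * a j| ≤
      2 * Real.exp ((∑ j, a j ^ 2) / 2) := by
  have exp_mean_le (b : J → ℝ) :
      𝔼 e : J → Bool, Real.exp (∑ j, boolSign (e j) * b j) ≤ Real.exp ((∑ j, b j ^ 2) / 2) := by
    rw [expect_exp_sum_boolSign_mul, Finset.sum_div, Real.exp_sum]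
    exact Finset.prod_le_prod (fun j _ => (Real.cosh_pos _).le)
      fun j _ => Real.cosh_le_exp_half_sq _
  have exp_mean_neg_le := exp_mean_le (-a)
  simp only [Pi.neg_apply, mul_neg, Finset.sum_neg_distrib, neg_sq] at exp_mean_neg_le
  calc _ ≤ 𝔼 e : J → Bool, (Real.exp (∑ j, boolSign (e j) * a j) +
          Real.exp (-∑ j, boolSign (e j) * a j)) :=
        Finset.expect_le_expect fun e _ => Real.exp_abs_le _
    _ ≤ _ := by
        rw [Finset.expect_add_distrib, two_mul]
        exact add_le_add (exp_mean_le a) exp_mean_neg_le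

variable {ι : Type*} [Fintype ι]

-- Hoeffding's inequality with a union bound.
theorem exists_signs_abs_sum_le (a : ι → J → ℝ) {v t : ℝ} (hv : 0 < v) (ht : 0 < t)
    (ha : ∀ i, ∑ j, a i j ^ 2 ≤ v) (hcard : 2 * (Fintype.card ι : ℝ) < Real.exp (t ^ 2 / (2 * v))) :
    ∃ ε : J → ℝ, (∀ j, |ε j| = 1) ∧ ∀ i, |∑ j, ε j * a i j| ≤ t := by
  classical
  let l : ℝ := t / v
  have hl : 0 < l := div_pos ht hv
  let S (i : ι) (e : J → Bool) : ℝ := ∑ j, boolSign (e j) * (l * a i j)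
  have mean_le (i : ι) : 𝔼 e, Real.exp |S i e| ≤ 2 * Real.exp (l ^ 2 * v / 2) := by
    refine (expect_exp_abs_sum_boolSign_mul_le fun j => l * a i j).trans ?_
    simp only [mul_pow, ← Finset.mul_sum]
    gcongr
    exact ha i
  have total_lt : 𝔼 e, ∑ i, Real.exp |S i e| < Real.exp (l * t) := calc
    𝔼 e, ∑ i, Real.exp |S i e| ≤ ∑ _i : ι, 2 * Real.exp (l ^ 2 * v / 2) := by
        rw [Finset.expect_sum_comm]
        exact Finset.sum_le_sum fun i _ => mean_le i
    _ = 2 * Fintype.card ι * Real.exp (l ^ 2 * v / 2) := by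
        rw [Finset.sum_const, Finset.card_univ, nsmul_eq_mul]
        ring
    _ < Real.exp (t ^ 2 / (2 * v)) * Real.exp (l ^ 2 * v / 2) := by gcongr
    _ = Real.exp (l * t) := by
        rw [← Real.exp_add]
        congr 1
        simp only [l]
        field_simp
        ring
  obtain ⟨e, -, he⟩ := Finset.exists_lt_of_expect_lt Finset.univ_nonempty total_lt
  refine ⟨fun j => boolSign (e j), fun j => abs_boolSign _, fun i => ?_⟩
  have exp_lt : Real.exp |S i e| < Real.exp (l * t) :=
    (Finset.single_le_sum (f := fun i => Real.exp |S i e|) (fun i _ => (Real.exp_pos _).le)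
      (Finset.mem_univ i)).trans_lt he
  have S_eq : S i e = l * ∑ j, boolSign (e j) * a i j := by
    simp only [S, Finset.mul_sum, mul_left_comm]
  rw [Real.exp_lt_exp, S_eq, abs_mul, abs_of_pos hl] at exp_lt
  exact (lt_of_mul_lt_mul_left exp_lt hl.le).le

theorem exists_signs_abs_expect_le [Nonempty J] (a : ι → J → ℝ) (ha : ∀ i j, |a i j| ≤ 1) {t : ℝ}
    (ht : 0 < t) (hcard : 2 * (Fintype.card ι : ℝ) < Real.exp (t ^ 2 * Fintype.card J / 2)) :
    ∃ ε : J → ℝ, (∀ j, |ε j| = 1) ∧ ∀ i, |𝔼 j, ε j * a i j| ≤ t := by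
  have hJ : (0 : ℝ) < Fintype.card J := by exact_mod_cast Fintype.card_pos
  have sum_sq_le (i : ι) : ∑ j, a i j ^ 2 ≤ (Fintype.card J : ℝ) := by
    simpa using Finset.sum_le_card_nsmul Finset.univ _ 1 fun j _ =>
      (sq_le_one_iff_abs_le_one _).2 (ha i j)
  obtain ⟨ε, hε, hsum⟩ := exists_signs_abs_sum_le a hJ (mul_pos ht hJ) sum_sq_le (by
    convert hcard using 2
    field_simp)
  refine ⟨ε, hε, fun i => ?_⟩
  rw [Fintype.expect_eq_sum_div_card, abs_div, abs_of_pos hJ, div_le_iff₀ hJ]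
  exact hsum i

theorem exists_signs_abs_expect_mul_le [Nonempty J] {β : Type*} [Fintype β] (a : ι → J → ℝ)
    (ha : ∀ i j, |a i j| ≤ 1) {t : ℝ} (ht : 0 < t)
    (hcard : 2 * ((Fintype.card β * Fintype.card ι : ℕ) : ℝ) <
      Real.exp (t ^ 2 * Fintype.card J / 2)) :
    ∃ f : β → J → ℝ, (∀ b j, |f b j| = 1) ∧
      Pairwise fun b b' => ∀ i, |𝔼 j, f b j * f b' j * a i j| ≤ t := by
  classical
  suffices ∀ s : Finset β, ∃ f : β → J → ℝ, (∀ b j, |f b j| = 1) ∧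
      (s : Set β).Pairwise fun b b' => ∀ i, |𝔼 j, f b j * f b' j * a i j| ≤ t by
    obtain ⟨f, hf, hflat⟩ := this Finset.univ
    exact ⟨f, hf, by simpa [Set.pairwise_univ] using hflat⟩
  intro s
  induction s using Finset.induction_on with
  | empty => exact ⟨fun _ _ => 1, fun _ _ => abs_one, by simp⟩
  | insert c s hc ih =>
    obtain ⟨f, hf, hflat⟩ := ih
    obtain ⟨ε, hε, hεflat⟩ := exists_signs_abs_expect_le (fun (i : β × ι) j => f i.1 j * a i.2 j)
      (fun i j => by rw [abs_mul, hf, one_mul]; exact ha _ _) ht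
      (by rwa [Fintype.card_prod])
    have symm : Std.Symm fun b b' => ∀ i, |𝔼 j, Function.update f c ε b j *
        Function.update f c ε b' j * a i j| ≤ t :=
      ⟨fun b b' h i => by simpa only [mul_comm (Function.update f c ε b' _)] using h i⟩
    have ne_of_mem {b : β} (hb : b ∈ s) : b ≠ c := fun h => hc (h ▸ hb)
    refine ⟨Function.update f c ε, fun b => ?_, ?_⟩
    · rcases eq_or_ne b c with rfl | hb
      · simpa using hε
      · simpa [hb] using hf b
    · rw [Finset.coe_insert, Set.pairwise_insert_of_symm_of_notMem hc]
      refine ⟨fun b hb b' hb' hbb' => ?_, fun b hb i => ?_⟩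
      · simpa [ne_of_mem hb, ne_of_mem hb'] using hflat hb hb' hbb'
      · simpa [ne_of_mem hb, mul_assoc] using hεflat (b, i)

end RandomSigns

section Walsh

variable {ι : Type*} [Fintype ι]

/-- The Walsh function of index `j` on the Boolean cube, as a symmetric matrix of signs. -/
def walsh (a j : ι → Bool) : ℝ := ∏ i, boolSign (a i && j i)

theorem abs_walsh (a j : ι → Bool) : |walsh a j| = 1 := by
  simp only [walsh, Finset.abs_prod, abs_boolSign, Finset.prod_const_one]

theorem expect_walsh_mul_walsh [DecidableEq ι] (j j' : ι → Bool) :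
    𝔼 a, walsh a j * walsh a j' = if j = j' then 1 else 0 := by
  have coordinate_mean (b b' : Bool) :
      𝔼 a, boolSign (a && b) * boolSign (a && b') = if b = b' then 1 else 0 := by
    rw [expect_bool]
    cases b <;> cases b' <;> norm_num [boolSign]
  simp only [walsh, ← Finset.prod_mul_distrib]
  rw [expect_prod_apply fun i a => boolSign (a && j i) * boolSign (a && j' i)]
  simp only [coordinate_mean, Finset.prod_ite_zero, Finset.prod_const_one, Finset.mem_univ,
    true_implies, funext_iff]

end Walsh

section Rademacher

variable {ι : Type*} [Fintype ι] [DecidableEq ι]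

theorem boolSign_apply_eq_walsh (b : ι → Bool) (c : ι) :
    boolSign (b c) = walsh b fun i => decide (i = c) := by
  rw [walsh, Finset.prod_eq_single c (fun i _ hi => by simp [boolSign, hi]) (by simp)]
  simp

theorem expect_boolSign_apply (c : ι) : 𝔼 b : ι → Bool, boolSign (b c) = 0 := by
  have walsh_zero (b : ι → Bool) : walsh b (fun _ => false) = 1 := by simp [walsh, boolSign]
  have h := expect_walsh_mul_walsh (fun i => decide (i = c)) (fun _ : ι => false)
  rw [if_neg fun h => by simpa using congrFun h c] at h
  simpa only [walsh_zero, mul_one, boolSign_apply_eq_walsh] using h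

theorem expect_boolSign_apply_mul_boolSign_apply (c c' : ι) :
    𝔼 b : ι → Bool, boolSign (b c) * boolSign (b c') = if c = c' then 1 else 0 := by
  simp only [boolSign_apply_eq_walsh, expect_walsh_mul_walsh, funext_iff, decide_eq_decide]
  exact if_congr ⟨fun h => (h c).1 rfl, fun h i => by rw [h]⟩ rfl rfl

end Rademacher

section ModulatedWalsh

variable {ι β : Type*} [Fintype ι]

/-- The Walsh functions on the copies `{b} × (ι → Bool)` of the Boolean cube, multiplied on the
copy `b` by the numbers `f b j`. -/
def modulatedWalsh (f : β → (ι → Bool) → ℝ) (j : ι → Bool) (g : β × (ι → Bool)) : ℝ :=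
  f g.1 j * walsh g.2 j

theorem abs_modulatedWalsh {f : β → (ι → Bool) → ℝ} (hf : ∀ b j, |f b j| = 1) (j : ι → Bool)
    (g : β × (ι → Bool)) : |modulatedWalsh f j g| = 1 := by
  rw [modulatedWalsh, abs_mul, hf, abs_walsh, one_mul]

theorem expect_mul_modulatedWalsh_mul_modulatedWalsh [DecidableEq ι] [Fintype β]
    (f f' : β → (ι → Bool) → ℝ) (c : β → ℝ) (i j : ι → Bool) :
    𝔼 g : β × (ι → Bool), c g.1 * (modulatedWalsh f i g * modulatedWalsh f' j g) =
      if i = j then 𝔼 b, c b * (f b i * f' b i) else 0 := by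
  have inner_mean (b : β) :
      𝔼 a, c b * (modulatedWalsh f i (b, a) * modulatedWalsh f' j (b, a)) =
        c b * (f b i * f' b j) * if i = j then 1 else 0 := by
    rw [← expect_walsh_mul_walsh, Finset.mul_expect]
    exact Finset.expect_congr rfl fun a _ => by simp only [modulatedWalsh]; ring
  rw [← Finset.univ_product_univ, Finset.expect_product]
  simp only [inner_mean]
  split_ifs with hij
  · simp only [hij, mul_one]
  · simp only [mul_zero, Finset.expect_const_zero]

end ModulatedWalsh

section DavieSystems

/-- Two families of functions on finite probability spaces `Ω n`, as in Davie's construction of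
subspaces of `ℓ^p` without the approximation property. The functions `lower n i` and `upper n i`
with the same index live on consecutive spaces; on each space all functions are orthonormal, while
the averaged kernels of the two families differ by at most `δ n`. -/
structure DavieSystem (𝕜 : Type*) [RCLike 𝕜] (Ω I : ℕ → Type*) [∀ n, Fintype (Ω n)]
    [∀ n, Fintype (I n)] [∀ n, DecidableEq (I n)] (δ : ℕ → ℝ) where
  lower : ∀ n, I n → Ω n → 𝕜
  upper : ∀ n, I n → Ω (n + 1) → 𝕜
  expect_lower_mul_lower : ∀ n i j, 𝔼 g, lower n i g * lower n j g = if i = j then 1 else 0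
  expect_upper_mul_upper : ∀ n i j, 𝔼 g, upper n i g * upper n j g = if i = j then 1 else 0
  expect_upper_mul_lower : ∀ n i j, 𝔼 g, upper n i g * lower (n + 1) j g = 0
  norm_kernel_sub_le : ∀ n g h, ‖𝔼 j, lower (n + 1) j g * lower (n + 1) j h -
    𝔼 i, upper n i g * upper n i h‖ ≤ δ n
  norm_cross_kernel_le : ∀ n g h, ‖𝔼 i, upper n i g * lower n i h‖ ≤ δ n

/-- The finite probability spaces carrying the sign functions: four copies of the Boolean cube. -/
abbrev BlockPoint (n : ℕ) : Type := (Bool → Bool) × (Fin n → Bool)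

/-- The index sets of the sign functions; `BlockIndex n` has twice as many elements as the Boolean
cube in `BlockPoint n` and as many as the one in `BlockPoint (n + 1)`. -/
abbrev BlockIndex (n : ℕ) : Type := Fin (n + 1) → Bool

/-- A bound which random averages over the `2 ^ n` points of a Boolean cube satisfy for up to
`2 ^ (2 * n + 5)` choices of coefficients simultaneously. -/
noncomputable def flatBound (n : ℕ) : ℝ := 6 * (3 / 4) ^ n

theorem flatBound_pos (n : ℕ) : 0 < flatBound n := by
  rw [flatBound]
  positivity

theorem two_mul_lt_exp_flatBound {n k : ℕ} (hk : k ≤ 2 ^ (2 * n + 5)) :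
    2 * (k : ℝ) < Real.exp (flatBound n ^ 2 * Fintype.card (Fin n → Bool) / 2) := by
  have exponent_eq : flatBound n ^ 2 * Fintype.card (Fin n → Bool) / 2 = 18 * (9 / 8) ^ n := by
    have geometric : ((3 / 4) ^ n) ^ 2 * 2 ^ n = (9 / 8 : ℝ) ^ n := by
      rw [← pow_mul, mul_comm n, pow_mul, ← mul_pow]
      norm_num
    simp only [flatBound, Fintype.card_fun, Fintype.card_bool, Fintype.card_fin, Nat.cast_pow,
      Nat.cast_ofNat, ← geometric]
    ring
  have le_exponent : ((2 * n + 6 : ℕ) : ℝ) ≤ 18 * (9 / 8) ^ n := by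
    have bernoulli := one_add_mul_le_pow (by norm_num : (-2 : ℝ) ≤ 1 / 8) n
    norm_num at bernoulli ⊢
    linarith [(Nat.cast_nonneg n : (0 : ℝ) ≤ n)]
  calc 2 * (k : ℝ) ≤ 2 * 2 ^ (2 * n + 5) := by gcongr; exact_mod_cast hk
    _ = 2 ^ (2 * n + 6) := by ring
    _ < Real.exp 1 ^ (2 * n + 6) :=
        pow_lt_pow_left₀ (by linarith [Real.exp_one_gt_d9]) (by norm_num) (by omega)
    _ = Real.exp (2 * n + 6 : ℕ) := by rw [← Real.exp_nat_mul, mul_one]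
    _ ≤ _ := by rw [exponent_eq]; exact Real.exp_le_exp.2 le_exponent

theorem exists_signs_flat_modulatedWalsh (n : ℕ) :
    ∃ f : (Bool → Bool) → (Fin n → Bool) → ℝ, (∀ b j, |f b j| = 1) ∧
      ∀ g h : BlockPoint n, g.1 ≠ h.1 →
        |𝔼 j, modulatedWalsh f j g * modulatedWalsh f j h| ≤ flatBound n := by
  obtain ⟨f, hf, hflat⟩ := exists_signs_abs_expect_mul_le (β := Bool → Bool)
    (fun (i : (Fin n → Bool) × (Fin n → Bool)) j => walsh i.1 j * walsh i.2 j)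
    (fun i j => by rw [abs_mul, abs_walsh, abs_walsh, one_mul]) (flatBound_pos n)
    (two_mul_lt_exp_flatBound (by
      simp only [Fintype.card_prod, Fintype.card_fun, Fintype.card_bool, Fintype.card_fin]
      calc 2 ^ 2 * (2 ^ n * 2 ^ n) = 2 ^ (2 * n + 2) := by ring
        _ ≤ 2 ^ (2 * n + 5) := Nat.pow_le_pow_right two_pos (by omega)))
  refine ⟨f, hf, fun g h hgh => ?_⟩
  simpa only [modulatedWalsh, mul_mul_mul_comm] using hflat hgh (g.2, h.2)

/-- The Walsh functions modulated by `f` and by one of the two coordinate signs of the copy of the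
cube; the first entry of the index selects the sign. -/
def splitWalsh {n : ℕ} (f : (Bool → Bool) → (Fin n → Bool) → ℝ) (j : BlockIndex n)
    (g : BlockPoint n) : ℝ :=
  boolSign (g.1 (j 0)) * modulatedWalsh f (Fin.tail j) g

section SplitWalsh

variable {n : ℕ} {f : (Bool → Bool) → (Fin n → Bool) → ℝ}

theorem abs_splitWalsh (hf : ∀ b j, |f b j| = 1) (j : BlockIndex n) (g : BlockPoint n) :
    |splitWalsh f j g| = 1 := by
  rw [splitWalsh, abs_mul, abs_boolSign, abs_modulatedWalsh hf, one_mul]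

theorem expect_splitWalsh_mul_splitWalsh (hf : ∀ b j, |f b j| = 1) (i j : BlockIndex n) :
    𝔼 g, splitWalsh f i g * splitWalsh f j g = if i = j then 1 else 0 := by
  have h := expect_mul_modulatedWalsh_mul_modulatedWalsh f f
    (fun b => boolSign (b (i 0)) * boolSign (b (j 0))) (Fin.tail i) (Fin.tail j)
  simp only [mul_self_of_abs_eq_one (hf _ _), mul_one,
    expect_boolSign_apply_mul_boolSign_apply] at h
  have eq_iff : i = j ↔ Fin.tail i = Fin.tail j ∧ i 0 = j 0 := by
    rw [← Fin.cons_self_tail i, ← Fin.cons_self_tail j, Fin.cons_inj, and_comm]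
    simp only [Fin.tail_cons, Fin.cons_zero]
  simp only [splitWalsh, mul_mul_mul_comm (boolSign _), h, eq_iff, ite_and]

theorem expect_modulatedWalsh_mul_splitWalsh {f' : (Bool → Bool) → (Fin n → Bool) → ℝ}
    {ε : (Fin n → Bool) → ℝ} (hff' : ∀ b j, f' b j * f b j = ε j) (i : Fin n → Bool)
    (j : BlockIndex n) : 𝔼 g, modulatedWalsh f' i g * splitWalsh f j g = 0 := by
  simp only [splitWalsh, mul_left_comm (modulatedWalsh f' i _)]
  rw [expect_mul_modulatedWalsh_mul_modulatedWalsh f' f fun b => boolSign (b (j 0))]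
  simp only [hff', ← Finset.expect_mul, expect_boolSign_apply, zero_mul, ite_self]

theorem expect_splitWalsh_kernel (f : (Bool → Bool) → (Fin n → Bool) → ℝ) (g h : BlockPoint n) :
    𝔼 j, splitWalsh f j g * splitWalsh f j h =
      (𝔼 c, boolSign (g.1 c) * boolSign (h.1 c)) *
        𝔼 j, modulatedWalsh f j g * modulatedWalsh f j h := by
  rw [Fintype.expect_mul_expect, ← Finset.expect_product', Finset.univ_product_univ]
  refine (Fintype.expect_equiv (Fin.consEquiv fun _ : Fin (n + 1) => Bool) _ _ ?_).symm
  rintro ⟨c, j⟩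
  exact mul_mul_mul_comm _ _ _ _

theorem abs_splitWalsh_kernel_sub_le {t : ℝ} (ht : 0 ≤ t)
    (hflat : ∀ g h : BlockPoint n, g.1 ≠ h.1 →
      |𝔼 j, modulatedWalsh f j g * modulatedWalsh f j h| ≤ t) (g h : BlockPoint n) :
    |𝔼 j, splitWalsh f j g * splitWalsh f j h -
      𝔼 j, modulatedWalsh f j g * modulatedWalsh f j h| ≤ 2 * t := by
  rw [expect_splitWalsh_kernel, ← sub_one_mul, abs_mul]
  rcases eq_or_ne g.1 h.1 with hgh | hgh
  · have mean_eq_one : 𝔼 c, boolSign (g.1 c) * boolSign (h.1 c) = 1 := by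
      simp only [hgh, mul_self_of_abs_eq_one (abs_boolSign _), Fintype.expect_one]
    rw [mean_eq_one, sub_self, abs_zero, zero_mul]
    positivity
  · have mean_abs_le_one : |𝔼 c, boolSign (g.1 c) * boolSign (h.1 c)| ≤ 1 :=
      (Finset.abs_expect_le _ _).trans (by simp [abs_mul, abs_boolSign])
    gcongr
    · rw [abs_le] at mean_abs_le_one ⊢
      constructor <;> linarith
    · exact hflat g h hgh

end SplitWalsh

theorem exists_signs_abs_expect_modulatedWalsh_mul_splitWalsh_le {n : ℕ}
    {f : (Bool → Bool) → (Fin n → Bool) → ℝ} (hf : ∀ b j, |f b j| = 1)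
    {f' : (Bool → Bool) → (Fin (n + 1) → Bool) → ℝ} (hf' : ∀ b j, |f' b j| = 1) :
    ∃ ε : BlockIndex n → ℝ, (∀ j, |ε j| = 1) ∧ ∀ g h,
      |𝔼 j, ε j * (modulatedWalsh f' j g * splitWalsh f j h)| ≤ flatBound (n + 1) := by
  obtain ⟨ε, hε, hflat⟩ := exists_signs_abs_expect_le
    (fun (i : BlockPoint (n + 1) × BlockPoint n) j => modulatedWalsh f' j i.1 * splitWalsh f j i.2)
    (fun i j => by rw [abs_mul, abs_modulatedWalsh hf', abs_splitWalsh hf, one_mul])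
    (flatBound_pos (n + 1)) (two_mul_lt_exp_flatBound (by
      simp only [Fintype.card_prod, Fintype.card_fun, Fintype.card_bool, Fintype.card_fin]
      calc 2 ^ 2 * 2 ^ (n + 1) * (2 ^ 2 * 2 ^ n) = 2 ^ (2 * n + 5) := by ring
        _ ≤ 2 ^ (2 * (n + 1) + 5) := Nat.pow_le_pow_right two_pos (by omega)))
  exact ⟨ε, hε, fun g h => hflat (g, h)⟩

theorem nonempty_davieSystem_real :
    Nonempty (DavieSystem ℝ BlockPoint BlockIndex fun n => 2 * flatBound (n + 1)) := by
  choose f hf hflat using exists_signs_flat_modulatedWalsh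
  choose ε hε hεflat using fun n =>
    exists_signs_abs_expect_modulatedWalsh_mul_splitWalsh_le (hf n) (hf (n + 1))
  have flatBound_le (n : ℕ) : flatBound n ≤ 2 * flatBound n := by linarith [flatBound_pos n]
  have twisted (n : ℕ) (j : BlockIndex n) (g : BlockPoint (n + 1)) :
      modulatedWalsh (fun b j => ε n j * f (n + 1) b j) j g =
        ε n j * modulatedWalsh (f (n + 1)) j g :=
    mul_assoc _ _ _
  have twisted_sq (n : ℕ) (b : Bool → Bool) (j : BlockIndex n) :
      ε n j * f (n + 1) b j * (ε n j * f (n + 1) b j) = 1 :=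
    mul_self_of_abs_eq_one (by rw [abs_mul, hε, hf, one_mul])
  exact ⟨{
    lower := fun n => splitWalsh (f n)
    upper := fun n => modulatedWalsh fun b j => ε n j * f (n + 1) b j
    expect_lower_mul_lower := fun n => expect_splitWalsh_mul_splitWalsh (hf n)
    expect_upper_mul_upper := fun n i j => by
      simpa only [one_mul, twisted_sq, Fintype.expect_one] using
        expect_mul_modulatedWalsh_mul_modulatedWalsh
          (fun b j => ε n j * f (n + 1) b j) (fun b j => ε n j * f (n + 1) b j) (fun _ => 1) i j
    expect_upper_mul_lower := fun n => expect_modulatedWalsh_mul_splitWalsh fun b j => by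
      rw [mul_assoc, mul_self_of_abs_eq_one (hf _ b j), mul_one]
    norm_kernel_sub_le := fun n g h => by
      simp only [twisted, mul_mul_mul_comm (ε n _), mul_self_of_abs_eq_one (hε n _), one_mul]
      exact abs_splitWalsh_kernel_sub_le (flatBound_pos _).le (hflat (n + 1)) g h
    norm_cross_kernel_le := fun n g h => by
      simp only [twisted, mul_assoc]
      exact (hεflat n g h).trans (flatBound_le (n + 1)) }⟩

variable {Ω I : ℕ → Type*} [∀ n, Fintype (Ω n)] [∀ n, Fintype (I n)] [∀ n, DecidableEq (I n)]
  {δ : ℕ → ℝ}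

/-- Extension of scalars of a real system. -/
noncomputable def DavieSystem.ofReal (𝕜 : Type*) [RCLike 𝕜] (D : DavieSystem ℝ Ω I δ) :
    DavieSystem 𝕜 Ω I δ where
  lower n i g := (D.lower n i g : 𝕜)
  upper n i g := (D.upper n i g : 𝕜)
  expect_lower_mul_lower n i j := by
    simpa only [RCLike.ofReal_expect, RCLike.ofReal_mul, apply_ite, RCLike.ofReal_one,
      RCLike.ofReal_zero] using congrArg (RCLike.ofReal (K := 𝕜)) (D.expect_lower_mul_lower n i j)
  expect_upper_mul_upper n i j := by
    simpa only [RCLike.ofReal_expect, RCLike.ofReal_mul, apply_ite, RCLike.ofReal_one,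
      RCLike.ofReal_zero] using congrArg (RCLike.ofReal (K := 𝕜)) (D.expect_upper_mul_upper n i j)
  expect_upper_mul_lower n i j := by
    simpa only [RCLike.ofReal_expect, RCLike.ofReal_mul, RCLike.ofReal_zero]
      using congrArg (RCLike.ofReal (K := 𝕜)) (D.expect_upper_mul_lower n i j)
  norm_kernel_sub_le n g h := by
    simpa only [← RCLike.ofReal_mul, ← RCLike.ofReal_expect, ← RCLike.ofReal_sub,
      RCLike.norm_ofReal, Real.norm_eq_abs] using D.norm_kernel_sub_le n g h
  norm_cross_kernel_le n g h := by
    simpa only [← RCLike.ofReal_mul, ← RCLike.ofReal_expect, RCLike.norm_ofReal, Real.norm_eq_abs]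
      using D.norm_cross_kernel_le n g h

end DavieSystems

section ApproximableOperators

variable {𝕜 : Type*} [RCLike 𝕜] {X Y : Type*} [NormedAddCommGroup X] [NormedSpace 𝕜 X]
  [NormedAddCommGroup Y] [NormedSpace 𝕜 Y]

theorem exists_eq_sum_smulRight {T : X →L[𝕜] Y} (hT : T ∈ finiteRankOperators 𝕜 X Y) :
    ∃ (k : ℕ) (φ : Fin k → X →L[𝕜] 𝕜) (y : Fin k → Y), T = ∑ i, (φ i).smulRight (y i) := by
  have : FiniteDimensional 𝕜 (LinearMap.range (T : X →ₗ[𝕜] Y)) := hT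
  let b := Module.finBasis 𝕜 (LinearMap.range (T : X →ₗ[𝕜] Y))
  let R : X →L[𝕜] LinearMap.range (T : X →ₗ[𝕜] Y) := T.codRestrict _ fun x => ⟨x, rfl⟩
  refine ⟨_, fun i => (LinearMap.toContinuousLinearMap (b.coord i)).comp R, fun i => b i, ?_⟩
  ext x
  have sum_repr := congrArg Subtype.val (b.sum_repr (R x))
  rw [Submodule.coe_sum] at sum_repr
  rw [sum_apply]
  exact sum_repr.symm

theorem apply_eq_zero_of_mem_approximableOperators {F : Type*} [NormedAddCommGroup F]
    [NormedSpace 𝕜 F] (τ : (X →L[𝕜] Y) →L[𝕜] F)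
    (hτ : ∀ (φ : X →L[𝕜] 𝕜) (y : Y), τ (φ.smulRight y) = 0)
    {T : X →L[𝕜] Y} (hT : T ∈ approximableOperators 𝕜 X Y) : τ T = 0 := by
  suffices approximableOperators 𝕜 X Y ≤ LinearMap.ker τ.toLinearMap from this hT
  refine Submodule.topologicalClosure_minimal _ (fun S hS => ?_) τ.isClosed_ker
  obtain ⟨k, φ, y, rfl⟩ := exists_eq_sum_smulRight hS
  simp [hτ]

end ApproximableOperators

section Averages

variable (𝕜 : Type*) [RCLike 𝕜] {ι M N : Type*} [Fintype ι] [AddCommGroup M] [Module 𝕜 M]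
  [AddCommGroup N] [Module 𝕜 N]

/-- The average of finitely many vectors of a space over `𝕜`. It replaces `Finset.expect`, which
asks for a module over `ℚ≥0`. -/
noncomputable def average (f : ι → M) : M := (Fintype.card ι : 𝕜)⁻¹ • ∑ i, f i

variable {𝕜}

theorem average_eq_expect (f : ι → 𝕜) : average 𝕜 f = 𝔼 i, f i := by
  rw [average, smul_eq_mul, Fintype.expect_eq_sum_div_card, div_eq_inv_mul]

theorem map_average {F : Type*} [FunLike F M N] [LinearMapClass F 𝕜 M N] (L : F) (f : ι → M) :
    L (average 𝕜 f) = average 𝕜 fun i => L (f i) := by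
  rw [average, average, map_smul, map_sum]

theorem average_add (f f' : ι → M) :
    average 𝕜 (fun i => f i + f' i) = average 𝕜 f + average 𝕜 f' := by
  simp only [average, Finset.sum_add_distrib, smul_add]

theorem average_smul_left (c : 𝕜) (f : ι → M) :
    average 𝕜 (fun i => c • f i) = c • average 𝕜 f := by
  simp only [average, ← Finset.smul_sum, smul_comm c]

theorem average_smul_eq_expect {A : Type*} (a : ι → 𝕜) (f : ι → A → 𝕜) :
    (average 𝕜 fun i => a i • f i) = fun g => 𝔼 i, a i * f i g := by
  funext g
  rw [← average_eq_expect]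
  simp [average]

end Averages

section DavieOperator

open Filter

/-- Isomorphic copies of the spaces of functions on the finite sets `Ω n`, with the supremum norm,
as uniformly complemented blocks of a normed space. -/
structure BlockSystem (𝕜 : Type*) [RCLike 𝕜] (Ω : ℕ → Type*) [∀ n, Fintype (Ω n)] (Y : Type*)
    [NormedAddCommGroup Y] [NormedSpace 𝕜 Y] (K : ℝ) where
  incl : ∀ n, (Ω n → 𝕜) →L[𝕜] Y
  proj : ∀ n, Y →L[𝕜] (Ω n → 𝕜)
  norm_incl_le : ∀ n, ‖incl n‖ ≤ 1
  norm_proj_le : ∀ n, ‖proj n‖ ≤ K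
  proj_incl : ∀ n f, proj n (incl n f) = f
  proj_incl_of_ne : ∀ {m n}, m ≠ n → ∀ f, proj m (incl n f) = 0

namespace BlockSystem

variable {𝕜 : Type*} [RCLike 𝕜] {Ω I : ℕ → Type*} [∀ n, Fintype (Ω n)] [∀ n, Fintype (I n)]
  [∀ n, DecidableEq (I n)] {δ : ℕ → ℝ} {Y : Type*} [NormedAddCommGroup Y] [NormedSpace 𝕜 Y]
  {K : ℝ} (B : BlockSystem 𝕜 Ω Y K) (D : DavieSystem 𝕜 Ω I δ)

/-- The vectors of Davie's construction, with weights `c`; each is supported by two consecutive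
blocks. -/
def vec (c : ℕ → 𝕜) (n : ℕ) (i : I n) : Y :=
  c n • B.incl n (D.lower n i) + c (n + 1) • B.incl (n + 1) (D.upper n i)

/-- The closed linear span of the vectors of Davie's construction. -/
def space (c : ℕ → 𝕜) : Submodule 𝕜 Y :=
  (Submodule.span 𝕜 (Set.range fun i : Σ n, I n => B.vec D c i.1 i.2)).topologicalClosure

theorem isClosed_space (c : ℕ → 𝕜) : IsClosed (B.space D c : Set Y) :=
  Submodule.isClosed_topologicalClosure _

/-- `BlockSystem.vec` as an element of `BlockSystem.space`. -/
def spaceVec (c : ℕ → 𝕜) (n : ℕ) (i : I n) : B.space D c :=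
  ⟨B.vec D c n i, Submodule.le_topologicalClosure _ (Submodule.subset_span ⟨⟨n, i⟩, rfl⟩)⟩

theorem space_le {c : ℕ → 𝕜} {V : Submodule 𝕜 Y} (hV : IsClosed (V : Set Y))
    (h : ∀ n i, B.vec D c n i ∈ V) : B.space D c ≤ V :=
  Submodule.topologicalClosure_minimal _
    (Submodule.span_le.2 (by rintro _ ⟨⟨n, i⟩, rfl⟩; exact h n i)) hV

theorem space_hom_ext {c : ℕ → 𝕜} {F : Type*} [NormedAddCommGroup F] [NormedSpace 𝕜 F]
    {S T : B.space D c →L[𝕜] F} (h : ∀ n i, S (B.spaceVec D c n i) = T (B.spaceVec D c n i)) :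
    S = T := by
  refine ContinuousLinearMap.ext_on
    (s := Set.range fun i : Σ n, I n => B.spaceVec D c i.1 i.2) ?_ ?_
  · have image_span : ((↑) : B.space D c → Y) ''
        (Submodule.span 𝕜 (Set.range fun i : Σ n, I n => B.spaceVec D c i.1 i.2) :
          Set (B.space D c)) =
        Submodule.span 𝕜 (Set.range fun i : Σ n, I n => B.vec D c i.1 i.2) := by
      rw [← Submodule.coe_subtype, ← Submodule.map_coe, Submodule.map_span, ← Set.range_comp]
      rfl
    exact Subtype.dense_iff.2 fun y hy => image_span ▸ hy
  · rintro _ ⟨⟨n, i⟩, rfl⟩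
    exact h n i

theorem proj_vec (c : ℕ → 𝕜) (n : ℕ) (i : I n) :
    B.proj n (B.vec D c n i) = c n • D.lower n i := by
  rw [vec, map_add, map_smul, map_smul, B.proj_incl, B.proj_incl_of_ne (by omega), smul_zero,
    add_zero]

theorem proj_succ_vec (c : ℕ → 𝕜) (n : ℕ) (i : I n) :
    B.proj (n + 1) (B.vec D c n i) = c (n + 1) • D.upper n i := by
  rw [vec, map_add, map_smul, map_smul, B.proj_incl, B.proj_incl_of_ne (by omega), smul_zero,
    zero_add]

theorem proj_vec_of_ne (c : ℕ → 𝕜) {m n : ℕ} (h : m ≠ n) (h' : m ≠ n + 1) (i : I n) :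
    B.proj m (B.vec D c n i) = 0 := by
  rw [vec, map_add, map_smul, map_smul, B.proj_incl_of_ne h, B.proj_incl_of_ne h',
    smul_zero, smul_zero, add_zero]

/-- The bilinear mean `h ↦ 𝔼 g, f g * h g` as a functional of `h`. -/
noncomputable def meanAgainst {A : Type*} [Fintype A] (f : A → 𝕜) : (A → 𝕜) →L[𝕜] 𝕜 :=
  average 𝕜 fun g => f g • ContinuousLinearMap.proj (φ := fun _ : A => 𝕜) g

theorem meanAgainst_apply {A : Type*} [Fintype A] (f h : A → 𝕜) :
    meanAgainst f h = 𝔼 g, f g * h g := by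
  rw [← average_eq_expect]
  simp [meanAgainst, average]

/-- The coefficient functional of a vector of Davie's construction, read off the lower block. -/
noncomputable def lowerCoef (n : ℕ) (i : I n) : Y →L[𝕜] 𝕜 :=
  (meanAgainst (D.lower n i)).comp (B.proj n)

/-- The coefficient functional of a vector of Davie's construction, read off the upper block. -/
noncomputable def upperCoef (n : ℕ) (i : I n) : Y →L[𝕜] 𝕜 :=
  (meanAgainst (D.upper n i)).comp (B.proj (n + 1))

theorem lowerCoef_apply (n : ℕ) (i : I n) (y : Y) :
    B.lowerCoef D n i y = 𝔼 g, D.lower n i g * B.proj n y g := meanAgainst_apply _ _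

theorem upperCoef_apply (n : ℕ) (i : I n) (y : Y) :
    B.upperCoef D n i y = 𝔼 g, D.upper n i g * B.proj (n + 1) y g := meanAgainst_apply _ _

theorem lowerCoef_vec (c : ℕ → 𝕜) (n : ℕ) (i j : I n) :
    B.lowerCoef D n i (B.vec D c n j) = if i = j then c n else 0 := by
  simp only [lowerCoef_apply, proj_vec, Pi.smul_apply, smul_eq_mul, mul_left_comm _ (c n),
    ← Finset.mul_expect, D.expect_lower_mul_lower, mul_ite, mul_one, mul_zero]

theorem upperCoef_vec (c : ℕ → 𝕜) (n : ℕ) (i j : I n) :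
    B.upperCoef D n i (B.vec D c n j) = if i = j then c (n + 1) else 0 := by
  simp only [upperCoef_apply, proj_succ_vec, Pi.smul_apply, smul_eq_mul, mul_left_comm _ (c _),
    ← Finset.mul_expect, D.expect_upper_mul_upper, mul_ite, mul_one, mul_zero]

theorem lowerCoef_vec_of_ne (c : ℕ → 𝕜) {m n : ℕ} (hmn : m ≠ n) (i : I m) (j : I n) :
    B.lowerCoef D m i (B.vec D c n j) = 0 := by
  rw [lowerCoef_apply]
  rcases eq_or_ne m (n + 1) with rfl | hmn'
  · simp only [proj_succ_vec, Pi.smul_apply, smul_eq_mul, mul_left_comm _ (c _),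
      ← Finset.mul_expect, mul_comm (D.lower _ _ _), D.expect_upper_mul_lower, mul_zero]
  · simp [B.proj_vec_of_ne D c hmn hmn']

theorem upperCoef_vec_of_ne (c : ℕ → 𝕜) {m n : ℕ} (hmn : m ≠ n) (i : I m) (j : I n) :
    B.upperCoef D m i (B.vec D c n j) = 0 := by
  rw [upperCoef_apply]
  rcases eq_or_ne (m + 1) n with rfl | hmn'
  · simp only [proj_vec, Pi.smul_apply, smul_eq_mul, mul_left_comm _ (c _),
      ← Finset.mul_expect, D.expect_upper_mul_lower, mul_zero]
  · simp [B.proj_vec_of_ne D c hmn' (by omega)]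

theorem lowerCoef_eq_upperCoef (n : ℕ) (i : I n) (y : B.space D 1) :
    B.lowerCoef D n i y = B.upperCoef D n i y := by
  suffices (B.lowerCoef D n i).comp (B.space D 1).subtypeL =
      (B.upperCoef D n i).comp (B.space D 1).subtypeL from congr($this y)
  refine B.space_hom_ext D fun m j => ?_
  change B.lowerCoef D n i (B.vec D 1 m j) = B.upperCoef D n i (B.vec D 1 m j)
  rcases eq_or_ne n m with rfl | hnm
  · rw [lowerCoef_vec, upperCoef_vec, Pi.one_apply, Pi.one_apply]
  · rw [B.lowerCoef_vec_of_ne D 1 hnm, B.upperCoef_vec_of_ne D 1 hnm]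

/-- The average of the diagonal coefficients of an operator over the vectors of level `n`. -/
noncomputable def trace (c : ℕ → 𝕜) (n : ℕ) : (B.space D c →L[𝕜] B.space D 1) →L[𝕜] 𝕜 :=
  average 𝕜 fun i => ((B.lowerCoef D n i).comp (B.space D 1).subtypeL).comp
    (ContinuousLinearMap.apply 𝕜 (B.space D 1) (B.spaceVec D c n i))

theorem trace_apply (c : ℕ → 𝕜) (n : ℕ) (S : B.space D c →L[𝕜] B.space D 1) :
    B.trace D c n S = 𝔼 i, B.lowerCoef D n i (S (B.spaceVec D c n i)) := by
  rw [← average_eq_expect]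
  simp [trace, average]

/-- The difference of two consecutive traces of `S` is the mean of `S (testVec g)` read off at
`g`. -/
noncomputable def testVec (c : ℕ → 𝕜) (n : ℕ) (g : Ω (n + 1)) : B.space D c :=
  (average 𝕜 fun j => D.lower (n + 1) j g • B.spaceVec D c (n + 1) j) -
    average 𝕜 fun i => D.upper n i g • B.spaceVec D c n i

theorem trace_succ_sub_trace (c : ℕ → 𝕜) (n : ℕ) (S : B.space D c →L[𝕜] B.space D 1) :
    B.trace D c (n + 1) S - B.trace D c n S =
      𝔼 g, B.proj (n + 1) (S (B.testVec D c n g)) g := by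
  have proj_apply_testVec (g : Ω (n + 1)) : B.proj (n + 1) (S (B.testVec D c n g)) g =
      (𝔼 j, D.lower (n + 1) j g * B.proj (n + 1) (S (B.spaceVec D c (n + 1) j)) g) -
        𝔼 i, D.upper n i g * B.proj (n + 1) (S (B.spaceVec D c n i)) g := by
    let L : B.space D c →L[𝕜] 𝕜 :=
      (ContinuousLinearMap.proj g).comp ((B.proj (n + 1)).comp ((B.space D 1).subtypeL.comp S))
    change L (B.testVec D c n g) = _
    rw [testVec, map_sub, map_average, map_average, average_eq_expect, average_eq_expect]
    simp only [map_smul, smul_eq_mul]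
    rfl
  simp only [proj_apply_testVec, Finset.expect_sub_distrib, trace_apply,
    B.lowerCoef_eq_upperCoef D n]
  simp only [lowerCoef_apply, upperCoef_apply]
  rw [Finset.expect_comm, Finset.expect_comm (s := (Finset.univ : Finset (I n)))]

theorem coe_average_smul_spaceVec (c : ℕ → 𝕜) (n : ℕ) (a : I n → 𝕜) :
    ((average 𝕜 fun i => a i • B.spaceVec D c n i : B.space D c) : Y) =
      c n • B.incl n (average 𝕜 fun i => a i • D.lower n i) +
        c (n + 1) • B.incl (n + 1) (average 𝕜 fun i => a i • D.upper n i) := by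
  rw [map_average, map_average, ← average_smul_left, ← average_smul_left, ← average_add]
  refine (map_average (B.space D c).subtype _).trans (congrArg _ (funext fun i => ?_))
  change a i • B.vec D c n i = _
  rw [vec, smul_add, map_smul, map_smul, smul_comm (a i), smul_comm (a i)]

theorem coe_testVec (c : ℕ → 𝕜) (n : ℕ) (g : Ω (n + 1)) :
    (B.testVec D c n g : Y) =
      c (n + 2) • B.incl (n + 2) (fun h => 𝔼 j, D.upper (n + 1) j h * D.lower (n + 1) j g) +
      c (n + 1) • B.incl (n + 1) (fun h => 𝔼 j, D.lower (n + 1) j g * D.lower (n + 1) j h -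
        𝔼 i, D.upper n i g * D.upper n i h) -
      c n • B.incl n (fun h => 𝔼 i, D.upper n i g * D.lower n i h) := by
  have kernel_sub_eq : (fun h => 𝔼 j, D.lower (n + 1) j g * D.lower (n + 1) j h -
        𝔼 i, D.upper n i g * D.upper n i h) =
      (average 𝕜 fun j => D.lower (n + 1) j g • D.lower (n + 1) j) -
        average 𝕜 fun i => D.upper n i g • D.upper n i := by
    rw [average_smul_eq_expect, average_smul_eq_expect]
    rfl
  rw [kernel_sub_eq]
  simp only [mul_comm _ (D.lower (n + 1) _ g), ← average_smul_eq_expect]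
  rw [testVec, Submodule.coe_sub, coe_average_smul_spaceVec, coe_average_smul_spaceVec, map_sub,
    smul_sub]
  abel

theorem norm_testVec_le [∀ n, Nonempty (Ω n)] (c : ℕ → 𝕜) (n : ℕ) (g : Ω (n + 1)) :
    ‖B.testVec D c n g‖ ≤
      (‖c (n + 1)‖ + ‖c (n + 2)‖) * δ (n + 1) + (‖c n‖ + ‖c (n + 1)‖) * δ n := by
  have norm_smul_incl_le (a : 𝕜) (m : ℕ) (f : Ω m → 𝕜) {r : ℝ} (hf : ∀ h, ‖f h‖ ≤ r) :
      ‖a • B.incl m f‖ ≤ ‖a‖ * r := by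
    rw [norm_smul]
    gcongr
    exact ((B.incl m).le_of_opNorm_le (B.norm_incl_le m) f).trans
      (by rw [one_mul]; exact (pi_norm_le_iff_of_nonempty _).2 hf)
  have δ_nonneg : 0 ≤ δ (n + 1) := (norm_nonneg _).trans
    (D.norm_cross_kernel_le (n + 1) (Classical.arbitrary _) (Classical.arbitrary _))
  have upper_block := norm_smul_incl_le (c (n + 2)) (n + 2) _
    fun h => D.norm_cross_kernel_le (n + 1) h g
  have middle_block := norm_smul_incl_le (c (n + 1)) (n + 1) _ (D.norm_kernel_sub_le n g)
  have lower_block := norm_smul_incl_le (c n) n _ (D.norm_cross_kernel_le n g)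
  rw [Submodule.coe_norm, coe_testVec]
  refine (norm_sub_le _ _).trans ((add_le_add_left (norm_add_le _ _) _).trans ?_)
  have := mul_nonneg (norm_nonneg (c (n + 1))) δ_nonneg
  linarith

theorem norm_trace_succ_sub_trace_le [∀ n, Nonempty (Ω n)] (c : ℕ → 𝕜) (n : ℕ) :
    ‖B.trace D c (n + 1) - B.trace D c n‖ ≤
      K * ((‖c (n + 1)‖ + ‖c (n + 2)‖) * δ (n + 1) + (‖c n‖ + ‖c (n + 1)‖) * δ n) := by
  set r := (‖c (n + 1)‖ + ‖c (n + 2)‖) * δ (n + 1) + (‖c n‖ + ‖c (n + 1)‖) * δ n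
  have K_nonneg : 0 ≤ K := (norm_nonneg _).trans (B.norm_proj_le 0)
  have r_nonneg : 0 ≤ r := (norm_nonneg _).trans (B.norm_testVec_le D c n (Classical.arbitrary _))
  refine ContinuousLinearMap.opNorm_le_bound _ (mul_nonneg K_nonneg r_nonneg) fun S => ?_
  have norm_proj_apply_le (g : Ω (n + 1)) :
      ‖B.proj (n + 1) (S (B.testVec D c n g)) g‖ ≤ K * r * ‖S‖ :=
    calc ‖B.proj (n + 1) (S (B.testVec D c n g)) g‖
        ≤ ‖B.proj (n + 1) (S (B.testVec D c n g))‖ := norm_le_pi_norm _ _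
      _ ≤ K * ‖S (B.testVec D c n g)‖ := (B.proj (n + 1)).le_of_opNorm_le (B.norm_proj_le _) _
      _ ≤ K * (‖S‖ * r) := by
        gcongr
        exact S.le_opNorm_of_le (B.norm_testVec_le D c n g)
      _ = K * r * ‖S‖ := by ring
  rw [sub_apply, trace_succ_sub_trace]
  exact (RCLike.norm_expect_le (K := 𝕜)).trans
    (Finset.expect_le Finset.univ_nonempty fun g _ => norm_proj_apply_le g)

theorem exists_tendsto_trace [∀ n, Nonempty (Ω n)] {c : ℕ → 𝕜}
    (hc : Summable fun n => (‖c n‖ + ‖c (n + 1)‖) * δ n) :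
    ∃ τ, Tendsto (B.trace D c) atTop (𝓝 τ) := by
  have dist_le (n : ℕ) : dist (B.trace D c n) (B.trace D c (n + 1)) ≤ _ :=
    (dist_eq_norm' (B.trace D c n) (B.trace D c (n + 1))).trans_le
      (B.norm_trace_succ_sub_trace_le D c n)
  exact cauchySeq_tendsto_of_complete (cauchySeq_of_dist_le_of_summable _ dist_le
    ((((summable_nat_add_iff 1).2 hc).add hc).mul_left K))

theorem apply_smulRight_eq_zero_of_tendsto_trace {c : ℕ → 𝕜}
    {τ : (B.space D c →L[𝕜] B.space D 1) →L[𝕜] 𝕜} (hτ : Tendsto (B.trace D c) atTop (𝓝 τ))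
    (φ : B.space D c →L[𝕜] 𝕜) (y : B.space D 1) : τ (φ.smulRight y) = 0 := by
  suffices τ.comp (ContinuousLinearMap.smulRightL 𝕜 (B.space D c) (B.space D 1) φ) = 0 from
    congr($this y)
  refine B.space_hom_ext D fun m i => ?_
  refine tendsto_nhds_unique (((ContinuousLinearMap.apply 𝕜 𝕜
    (φ.smulRight (B.spaceVec D 1 m i))).continuous.tendsto τ).comp hτ)
    (tendsto_const_nhds.congr' ?_)
  filter_upwards [eventually_gt_atTop m] with n hn
  have coef_eq_zero (j : I n) : B.lowerCoef D n j (B.spaceVec D 1 m i : Y) = 0 :=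
    B.lowerCoef_vec_of_ne D 1 hn.ne' j i
  simp [trace_apply, coef_eq_zero]

theorem notMem_approximableOperators_of_map_spaceVec [∀ n, Nonempty (Ω n)]
    [∀ n, Nonempty (I n)] {c : ℕ → 𝕜} (hc : Summable fun n => (‖c n‖ + ‖c (n + 1)‖) * δ n)
    {S : B.space D c →L[𝕜] B.space D 1}
    (hS : ∀ n i, S (B.spaceVec D c n i) = B.spaceVec D 1 n i) :
    S ∉ approximableOperators 𝕜 (B.space D c) (B.space D 1) := by
  intro approximable
  obtain ⟨τ, hτ⟩ := B.exists_tendsto_trace D hc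
  have trace_eq_one (n : ℕ) : B.trace D c n S = 1 := by
    have coef_eq_one (i : I n) : B.lowerCoef D n i (B.spaceVec D 1 n i : Y) = 1 :=
      (B.lowerCoef_vec D 1 n i i).trans (if_pos rfl)
    simp [trace_apply, hS, coef_eq_one]
  have limit_eq_one : τ S = 1 := tendsto_nhds_unique
    (((ContinuousLinearMap.apply 𝕜 𝕜 S).continuous.tendsto τ).comp hτ)
    (tendsto_const_nhds.congr fun n => (trace_eq_one n).symm)
  exact one_ne_zero (limit_eq_one.symm.trans (apply_eq_zero_of_mem_approximableOperators τ
    (B.apply_smulRight_eq_zero_of_tendsto_trace D hτ) approximable))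

/-- The operator which multiplies the `n`-th block by `w n` and annihilates the complement of the
blocks; it is `0` if the series defining it is not summable. -/
noncomputable def diagonal (w : ℕ → 𝕜) : Y →L[𝕜] Y := ∑' n, w n • (B.incl n).comp (B.proj n)

variable [CompleteSpace Y]

theorem summable_diagonal {w : ℕ → 𝕜} (hw : Summable fun n => ‖w n‖) :
    Summable fun n => w n • (B.incl n).comp (B.proj n) := by
  refine Summable.of_norm_bounded (hw.mul_right K) fun n => ?_
  rw [norm_smul]
  gcongr
  exact (ContinuousLinearMap.opNorm_comp_le _ _).trans
    ((mul_le_mul (B.norm_incl_le n) (B.norm_proj_le n) (norm_nonneg _) zero_le_one).trans_eq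
      (one_mul K))

theorem diagonal_incl {w : ℕ → 𝕜} (hw : Summable fun n => ‖w n‖) (n : ℕ) (f : Ω n → 𝕜) :
    B.diagonal w (B.incl n f) = w n • B.incl n f := by
  have sum_apply := (ContinuousLinearMap.apply 𝕜 Y (B.incl n f)).hasSum
    (B.summable_diagonal hw).hasSum
  refine (sum_apply.unique (hasSum_single n fun m hm => ?_)).trans ?_
  · simp [B.proj_incl_of_ne hm]
  · simp [B.proj_incl]

theorem diagonal_vec {w : ℕ → 𝕜} (hw : Summable fun n => ‖w n‖) (c : ℕ → 𝕜) (n : ℕ) (i : I n) :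
    B.diagonal w (B.vec D c n i) = B.vec D (w * c) n i := by
  simp only [vec, map_add, map_smul, B.diagonal_incl hw, smul_smul, Pi.mul_apply, mul_comm (c _)]

theorem isCompactOperator_diagonal {w : ℕ → 𝕜} (hw : Summable fun n => ‖w n‖) :
    IsCompactOperator (B.diagonal w) := by
  have isClosed_compact : IsClosed (compactOperators 𝕜 Y Y : Set (Y →L[𝕜] Y)) :=
    isClosed_setOfPred_isCompactOperator
  have compact_term (n : ℕ) : w n • (B.incl n).comp (B.proj n) ∈ compactOperators 𝕜 Y Y :=
    Submodule.smul_mem _ _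
      ((isCompactOperator_of_locallyCompactSpace_dom (B.proj n)).clm_comp (B.incl n))
  exact isClosed_compact.mem_of_tendsto (B.summable_diagonal hw).hasSum
    (Eventually.of_forall fun s => Submodule.sum_mem _ fun n _ => compact_term n)

theorem exists_isCompactOperator_notMem_approximableOperators [∀ n, Nonempty (Ω n)]
    [∀ n, Nonempty (I n)] {w : ℕ → 𝕜} (w_ne_zero : ∀ n, w n ≠ 0) (hw : Summable fun n => ‖w n‖)
    (hc : Summable fun n => (‖(w n)⁻¹‖ + ‖(w (n + 1))⁻¹‖) * δ n) :
    ∃ T : B.space D w⁻¹ →L[𝕜] B.space D 1, IsCompactOperator T ∧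
      T ∉ approximableOperators 𝕜 (B.space D w⁻¹) (B.space D 1) := by
  have diagonal_vec_eq (n : ℕ) (i : I n) : B.diagonal w (B.vec D w⁻¹ n i) = B.vec D 1 n i := by
    rw [B.diagonal_vec D hw, show w * w⁻¹ = 1 from funext fun k => mul_inv_cancel₀ (w_ne_zero k)]
  have diagonal_mem : B.space D w⁻¹ ≤ (B.space D 1).comap (B.diagonal w).toLinearMap :=
    B.space_le D ((B.isClosed_space D 1).preimage (B.diagonal w).continuous) fun n i => by
      rw [Submodule.mem_comap]
      exact (diagonal_vec_eq n i).symm ▸ (B.spaceVec D 1 n i).2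
  refine ⟨((B.diagonal w).comp (B.space D w⁻¹).subtypeL).codRestrict _
    fun x => diagonal_mem x.2, ?_, ?_⟩
  · exact ((B.isCompactOperator_diagonal hw).comp_clm (B.space D w⁻¹).subtypeL).codRestrict _
      (B.isClosed_space D 1)
  · exact B.notMem_approximableOperators_of_map_spaceVec D hc fun n i =>
      Subtype.ext (diagonal_vec_eq n i)

end BlockSystem

theorem BlockSystem.exists_closed_subspaces_compact_notMem_approximableOperators {𝕜 : Type*}
    [RCLike 𝕜] {Y : Type*} [NormedAddCommGroup Y] [NormedSpace 𝕜 Y] [CompleteSpace Y] {K : ℝ}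
    (B : BlockSystem 𝕜 BlockPoint Y K) :
    ∃ V W : Submodule 𝕜 Y, IsClosed (V : Set Y) ∧ IsClosed (W : Set Y) ∧
      ∃ T : V →L[𝕜] W, IsCompactOperator T ∧ T ∉ approximableOperators 𝕜 V W := by
  obtain ⟨D₀⟩ := nonempty_davieSystem_real
  let D := D₀.ofReal 𝕜
  let w (n : ℕ) : 𝕜 := (4 / 5) ^ n
  have norm_w (n : ℕ) : ‖w n‖ = (4 / 5) ^ n := by simp [w]
  refine ⟨B.space D w⁻¹, B.space D 1, B.isClosed_space D _, B.isClosed_space D _,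
    B.exists_isCompactOperator_notMem_approximableOperators D (fun n => by simp [w]) ?_ ?_⟩
  · simp only [norm_w]
    exact summable_geometric_of_lt_one (by norm_num) (by norm_num)
  · have term_eq (n : ℕ) : (‖(w n)⁻¹‖ + ‖(w (n + 1))⁻¹‖) * (2 * flatBound (n + 1)) =
        81 / 4 * (15 / 16) ^ n := by
      have geometric : (15 / 16 : ℝ) ^ n = ((4 / 5) ^ n)⁻¹ * (3 / 4) ^ n := by
        rw [← inv_pow, ← mul_pow]
        norm_num
      rw [norm_inv, norm_inv, norm_w, norm_w, flatBound, geometric, pow_succ, pow_succ, mul_inv]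
      ring
    simp only [term_eq]
    exact (summable_geometric_of_lt_one (by norm_num) (by norm_num)).mul_left _

end DavieOperator

section ApproximableIdeal

variable {𝕜 : Type*} [RCLike 𝕜] {X Y Z : Type*} [NormedAddCommGroup X] [NormedSpace 𝕜 X]
  [NormedAddCommGroup Y] [NormedSpace 𝕜 Y] [NormedAddCommGroup Z] [NormedSpace 𝕜 Z]

theorem mem_approximableOperators_of_finiteDimensional_range {T : X →L[𝕜] Y}
    (hT : FiniteDimensional 𝕜 (LinearMap.range (T : X →ₗ[𝕜] Y))) :
    T ∈ approximableOperators 𝕜 X Y :=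
  (finiteRankOperators 𝕜 X Y).le_topologicalClosure hT

theorem clm_comp_mem_approximableOperators (R : Y →L[𝕜] Z) {S : X →L[𝕜] Y}
    (hS : S ∈ approximableOperators 𝕜 X Y) : R.comp S ∈ approximableOperators 𝕜 X Z := by
  refine map_mem_closure (ContinuousLinearMap.compL 𝕜 X Y Z R).continuous hS
    fun S (hS : FiniteDimensional 𝕜 (LinearMap.range (S : X →ₗ[𝕜] Y))) => ?_
  change FiniteDimensional 𝕜 (LinearMap.range ((R : Y →ₗ[𝕜] Z) ∘ₗ (S : X →ₗ[𝕜] Y)))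
  rw [LinearMap.range_comp]
  infer_instance

theorem comp_clm_mem_approximableOperators {S : Y →L[𝕜] Z}
    (hS : S ∈ approximableOperators 𝕜 Y Z) (R : X →L[𝕜] Y) :
    S.comp R ∈ approximableOperators 𝕜 X Z := by
  refine map_mem_closure (f := fun S : Y →L[𝕜] Z => S.comp R)
    ((ContinuousLinearMap.compL 𝕜 X Y Z).flip R).continuous hS
    fun S (hS : FiniteDimensional 𝕜 (LinearMap.range (S : Y →ₗ[𝕜] Z))) => ?_
  change FiniteDimensional 𝕜 (LinearMap.range ((S : Y →ₗ[𝕜] Z) ∘ₗ (R : X →ₗ[𝕜] Y)))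
  exact Submodule.finiteDimensional_of_le (LinearMap.range_comp_le_range _ _)

theorem comp_comp_notMem_approximableOperators {X₀ Y₀ : Type*}
    [NormedAddCommGroup X₀] [NormedSpace 𝕜 X₀] [NormedAddCommGroup Y₀] [NormedSpace 𝕜 Y₀]
    {T : X →L[𝕜] Y} (hT : T ∉ approximableOperators 𝕜 X Y)
    {J : X₀ →L[𝕜] X} {P : X →L[𝕜] X₀}
    (hJP : .id 𝕜 X - J.comp P ∈ approximableOperators 𝕜 X X)
    {I : Y₀ →L[𝕜] Y} {Q : Y →L[𝕜] Y₀}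
    (hIQ : .id 𝕜 Y - I.comp Q ∈ approximableOperators 𝕜 Y Y) :
    Q.comp (T.comp J) ∉ approximableOperators 𝕜 X₀ Y₀ := by
  intro h
  have hsplit : T = T.comp (.id 𝕜 X - J.comp P) +
      ((ContinuousLinearMap.id 𝕜 Y - I.comp Q).comp (T.comp (J.comp P)) +
        (I.comp (Q.comp (T.comp J))).comp P) := by
    ext x
    simp
  rw [hsplit] at hT
  exact hT (add_mem (clm_comp_mem_approximableOperators T hJP)
    (add_mem (comp_clm_mem_approximableOperators hIQ _)
      (comp_clm_mem_approximableOperators (clm_comp_mem_approximableOperators I h) P)))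

theorem exists_compact_one_le_norm_sub_of_notMem_approximableOperators [CompleteSpace Y]
    {T : X →L[𝕜] Y} (hc : IsCompactOperator T) (hT : T ∉ approximableOperators 𝕜 X Y) :
    ∃ R : X →L[𝕜] Y, IsCompactOperator R ∧ ‖R‖ ≤ 3 ∧
      ∀ S ∈ approximableOperators 𝕜 X Y, 1 ≤ ‖R - S‖ := by
  let A := (approximableOperators 𝕜 X Y).submoduleOf (compactOperators 𝕜 X Y)
  have hA : IsClosed (A : Set (compactOperators 𝕜 X Y)) :=
    (finiteRankOperators 𝕜 X Y).isClosed_topologicalClosure.preimage continuous_subtype_val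
  obtain ⟨R, hR3, hR⟩ := riesz_lemma_of_norm_lt (E := compactOperators 𝕜 X Y) (c := (2 : 𝕜))
    (R := 3) (by norm_num) (by norm_num) hA ⟨⟨T, hc⟩, hT⟩
  exact ⟨R, R.2, hR3, fun S hS =>
    hR ⟨S, approximableOperators_le_compactOperators 𝕜 X Y hS⟩ hS⟩

end ApproximableIdeal

section Hyperplanes

variable {𝕜 : Type*} [RCLike 𝕜] {Y : Type*} [NormedAddCommGroup Y] [NormedSpace 𝕜 Y]

/-- The hyperplane `W ∩ ker f` of a subspace `W`; it is all of `W` if `f` vanishes there. -/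
def hyperplane (W : Submodule 𝕜 Y) (f : Y →L[𝕜] 𝕜) : Submodule 𝕜 Y :=
  W ⊓ LinearMap.ker (f : Y →ₗ[𝕜] 𝕜)

theorem mem_hyperplane {W : Submodule 𝕜 Y} {f : Y →L[𝕜] 𝕜} {x : Y} :
    x ∈ hyperplane W f ↔ x ∈ W ∧ f x = 0 := Iff.rfl

theorem isClosed_hyperplane {W : Submodule 𝕜 Y} (hW : IsClosed (W : Set Y)) (f : Y →L[𝕜] 𝕜) :
    IsClosed (hyperplane W f : Set Y) := hW.inter f.isClosed_ker

/-- The inclusion of `hyperplane W f` into `W`. -/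
def hyperplaneIncl (W : Submodule 𝕜 Y) (f : Y →L[𝕜] 𝕜) : hyperplane W f →L[𝕜] W :=
  (hyperplane W f).subtypeL.codRestrict W fun x => x.2.1

/-- The projection of `W` onto `hyperplane W f` along a vector `x` with `f x = 1`. -/
def hyperplaneProj {W : Submodule 𝕜 Y} (f : Y →L[𝕜] 𝕜) {x : Y} (hx : x ∈ W) (hfx : f x = 1) :
    W →L[𝕜] hyperplane W f :=
  (W.subtypeL - (f.comp W.subtypeL).smulRight x).codRestrict (hyperplane W f) fun w =>
    ⟨W.sub_mem w.2 (W.smul_mem _ hx), by simp [hfx]⟩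

theorem id_sub_hyperplaneIncl_comp_proj_mem_approximableOperators {W : Submodule 𝕜 Y}
    (f : Y →L[𝕜] 𝕜) {x : Y} (hx : x ∈ W) (hfx : f x = 1) :
    .id 𝕜 W - (hyperplaneIncl W f).comp (hyperplaneProj f hx hfx) ∈
      approximableOperators 𝕜 W W := by
  refine mem_approximableOperators_of_finiteDimensional_range
    (Submodule.finiteDimensional_of_le (S₂ := Submodule.span 𝕜 {⟨x, hx⟩}) ?_)
  rintro _ ⟨w, rfl⟩
  exact Submodule.mem_span_singleton.2 ⟨f w, Subtype.ext (sub_sub_cancel (w : Y) (f w • x)).symm⟩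

theorem exists_biorthogonal_pair_of_not_finiteDimensional {W : Submodule 𝕜 Y}
    (hW : ¬ FiniteDimensional 𝕜 W) :
    ∃ x ∈ W, ∃ y ∈ W, ∃ f g : Y →L[𝕜] 𝕜, f x = 1 ∧ f y = 0 ∧ g x = 0 ∧ g y = 1 := by
  have hbot : W ≠ ⊥ := by
    rintro rfl
    exact hW inferInstance
  obtain ⟨x, hxW, hx0⟩ := Submodule.exists_mem_ne_zero_of_ne_bot hbot
  obtain ⟨f, hfx⟩ := SeparatingDual.exists_eq_one (R := 𝕜) hx0
  obtain ⟨y, hyW, hfy, hy0⟩ : ∃ y ∈ W, f y = 0 ∧ y ≠ 0 := by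
    by_contra! hker
    refine hW (Submodule.finiteDimensional_of_le (S₂ := Submodule.span 𝕜 {x}) fun w hw => ?_)
    have hw0 := hker (w - f w • x) (W.sub_mem hw (W.smul_mem _ hxW)) (by simp [hfx])
    exact Submodule.mem_span_singleton.2 ⟨f w, (sub_eq_zero.1 hw0).symm⟩
  obtain ⟨g, hgy⟩ := SeparatingDual.exists_eq_one (R := 𝕜) hy0
  exact ⟨x, hxW, y, hyW, f, g - g x • f, hfx, hfy, by simp [hfx], by simp [hfy, hgy]⟩

theorem exists_injective_hyperplane {W : Submodule 𝕜 Y} (hW : ¬ FiniteDimensional 𝕜 W) :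
    ∃ x ∈ W, ∃ f : ℝ → Y →L[𝕜] 𝕜, (∀ t, f t x = 1) ∧
      Function.Injective fun t => hyperplane W (f t) := by
  obtain ⟨x, hx, y, hy, f, g, hfx, hfy, hgx, hgy⟩ :=
    exists_biorthogonal_pair_of_not_finiteDimensional hW
  let h : ℝ → Y →L[𝕜] 𝕜 := fun t => f + (t : 𝕜) • g
  have h_apply (r t : ℝ) : h r ((t : 𝕜) • x - y) = (t : 𝕜) - r := by
    simp [h, hfx, hfy, hgx, hgy, sub_eq_add_neg]
  refine ⟨x, hx, h, fun t => by simp [h, hfx, hgx], fun t r htr => ?_⟩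
  have hmem : (t : 𝕜) • x - y ∈ hyperplane W (h r) :=
    htr.le (mem_hyperplane.2 ⟨W.sub_mem (W.smul_mem _ hx) hy, by rw [h_apply, sub_self]⟩)
  rw [mem_hyperplane, h_apply, sub_eq_zero] at hmem
  exact RCLike.ofReal_injective hmem.2

theorem exists_injective_compact_one_le_norm_sub_approximable [CompleteSpace Y]
    {V W : Submodule 𝕜 Y} (hV : IsClosed (V : Set Y)) (hW : IsClosed (W : Set Y))
    {T : V →L[𝕜] W} (hc : IsCompactOperator T) (hT : T ∉ approximableOperators 𝕜 V W) :
    ∃ (a b : ℝ → ClosedInfDimSubspace 𝕜 Y) (R : ∀ t, (a t).1 →L[𝕜] (b t).1),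
      Function.Injective a ∧ Function.Injective b ∧ ∀ t, IsCompactOperator (R t) ∧ ‖R t‖ ≤ 3 ∧
        ∀ S ∈ approximableOperators 𝕜 (a t).1 (b t).1, 1 ≤ ‖R t - S‖ := by
  have not_finite_dom {V W : Submodule 𝕜 Y} {T : V →L[𝕜] W}
      (hT : T ∉ approximableOperators 𝕜 V W) : ¬ FiniteDimensional 𝕜 V := fun _ =>
    hT (mem_approximableOperators_of_finiteDimensional_range inferInstance)
  have not_finite_cod {V W : Submodule 𝕜 Y} {T : V →L[𝕜] W}
      (hT : T ∉ approximableOperators 𝕜 V W) : ¬ FiniteDimensional 𝕜 W := fun _ =>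
    hT (mem_approximableOperators_of_finiteDimensional_range inferInstance)
  obtain ⟨x, hx, f, hfx, hf⟩ := exists_injective_hyperplane (not_finite_dom hT)
  obtain ⟨y, hy, g, hgy, hg⟩ := exists_injective_hyperplane (not_finite_cod hT)
  let C (t : ℝ) : hyperplane V (f t) →L[𝕜] hyperplane W (g t) :=
    (hyperplaneProj (g t) hy (hgy t)).comp (T.comp (hyperplaneIncl V (f t)))
  have hC (t : ℝ) : IsCompactOperator (C t) :=
    (hc.comp_clm (hyperplaneIncl V (f t))).clm_comp (hyperplaneProj (g t) hy (hgy t))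
  have hCA (t : ℝ) : C t ∉ approximableOperators 𝕜 _ _ :=
    comp_comp_notMem_approximableOperators hT
      (id_sub_hyperplaneIncl_comp_proj_mem_approximableOperators (f t) hx (hfx t))
      (id_sub_hyperplaneIncl_comp_proj_mem_approximableOperators (g t) hy (hgy t))
  have (t : ℝ) : CompleteSpace (hyperplane W (g t)) :=
    (isClosed_hyperplane hW (g t)).completeSpace_coe
  choose R hR using fun t =>
    exists_compact_one_le_norm_sub_of_notMem_approximableOperators (hC t) (hCA t)
  exact ⟨fun t => ⟨hyperplane V (f t), isClosed_hyperplane hV _, not_finite_dom (hCA t)⟩,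
    fun t => ⟨hyperplane W (g t), isClosed_hyperplane hW _, not_finite_cod (hCA t)⟩, R,
    fun _ _ h => hf (congrArg Subtype.val h), fun _ _ h => hg (congrArg Subtype.val h), hR⟩

end Hyperplanes

section DirectSumCoordinates

theorem lp_norm_le_mul_norm_of_injOn {ι κ : Type*} {E : ι → Type*} {F : κ → Type*}
    [∀ i, NormedAddCommGroup (E i)] [∀ j, NormedAddCommGroup (F j)] {p : ℝ≥0∞} [Fact (1 ≤ p)]
    {x : lp E p} {y : lp F p} {σ : κ → ι} (hσ : Set.InjOn σ {j | y j ≠ 0}) {K : ℝ} (hK : 0 ≤ K)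
    (hyx : ∀ j, ‖y j‖ ≤ K * ‖x (σ j)‖) : ‖y‖ ≤ K * ‖x‖ := by
  classical
  have hp1 : 1 ≤ p := Fact.out
  rcases eq_or_ne p ∞ with rfl | hp
  · refine lp.norm_le_of_forall_le (by positivity) fun j => (hyx j).trans ?_
    gcongr
    exact lp.norm_apply_le_norm ENNReal.top_ne_zero x (σ j)
  · have hp0 : 0 < p.toReal := ENNReal.toReal_pos (zero_lt_one.trans_le hp1).ne' hp
    refine lp.norm_le_of_forall_sum_le hp0 (by positivity) fun s => ?_
    have hσs : Set.InjOn σ (s.filter (y · ≠ 0)) := hσ.mono fun j hj => (Finset.mem_filter.1 hj).2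
    calc ∑ j ∈ s, ‖y j‖ ^ p.toReal
        = ∑ j ∈ s with y j ≠ 0, ‖y j‖ ^ p.toReal :=
          (Finset.sum_filter_of_ne (p := fun j => y j ≠ 0) fun j _ hj h0 => hj (by
            rw [h0, norm_zero, Real.zero_rpow hp0.ne'])).symm
      _ ≤ ∑ j ∈ s with y j ≠ 0, (K * ‖x (σ j)‖) ^ p.toReal := by
          gcongr with j
          exact hyx j
      _ = K ^ p.toReal * ∑ i ∈ (s.filter (y · ≠ 0)).image σ, ‖x i‖ ^ p.toReal := by
          rw [Finset.sum_image hσs, Finset.mul_sum]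
          simp only [Real.mul_rpow hK (norm_nonneg _)]
      _ ≤ K ^ p.toReal * ‖x‖ ^ p.toReal := by
          gcongr
          exact lp.sum_rpow_le_norm_rpow hp0 x _
      _ = (K * ‖x‖) ^ p.toReal := (Real.mul_rpow hK (norm_nonneg _)).symm

variable {𝕜 : Type*} [RCLike 𝕜] {ι : Type*} {E : ι → Type*}
  [∀ i, NormedAddCommGroup (E i)] [∀ i, NormedSpace 𝕜 (E i)] {p : ℝ≥0∞} [hp : Fact (1 ≤ p)]

theorem isClosed_lpDirectSum : IsClosed (lpDirectSum 𝕜 E p : Set (lp E p)) := by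
  refine isClosed_of_closure_subset fun x hx hpt => ?_
  rw [Metric.tendsto_nhds]
  intro ε hε
  obtain ⟨y, hy, hxy⟩ := Metric.mem_closure_iff.1 hx (ε / 2) (half_pos hε)
  filter_upwards [Metric.tendsto_nhds.1 (hy hpt) (ε / 2) (half_pos hε)] with i hi
  have hxyi : ‖x i - y i‖ ≤ ‖x - y‖ :=
    lp.norm_apply_le_norm (zero_lt_one.trans_le hp.out).ne' (x - y) i
  rw [dist_eq_norm] at hxy
  rw [dist_zero_right, norm_norm] at hi ⊢
  linarith [norm_le_norm_sub_add (x i) (y i)]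

instance completeSpace_lpDirectSum [∀ i, CompleteSpace (E i)] :
    CompleteSpace (lpDirectSum 𝕜 E p) :=
  isClosed_lpDirectSum.completeSpace_coe

open Classical in
theorem single_mem_lpDirectSum (i : ι) (x : E i) : lp.single p i x ∈ lpDirectSum 𝕜 E p := by
  refine fun _ => tendsto_const_nhds.congr' ?_
  filter_upwards [(Set.finite_singleton i).compl_mem_cofinite] with j hj
  rw [lp.single_apply_ne p i x hj, norm_zero]

/-- A presentation of a normed space `Z` as a direct sum of the spaces `E i`, whose norm only
depends on the norms of the coordinates up to rearrangement and is monotone in them. All `ℓ^p`-sums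
and `c₀`-sums are of this kind. -/
structure DirectSumStructure (𝕜 : Type*) [RCLike 𝕜] {ι : Type*} (E : ι → Type*)
    [∀ i, NormedAddCommGroup (E i)] [∀ i, NormedSpace 𝕜 (E i)] (Z : Type*) [NormedAddCommGroup Z]
    [NormedSpace 𝕜 Z] where
  single : ∀ i, E i →L[𝕜] Z
  proj : ∀ i, Z →L[𝕜] E i
  norm_single_apply_le : ∀ i x, ‖single i x‖ ≤ ‖x‖
  norm_proj_apply_le : ∀ i x, ‖proj i x‖ ≤ ‖x‖
  proj_single_self : ∀ i x, proj i (single i x) = x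
  proj_single_of_ne : ∀ {i j}, j ≠ i → ∀ x, proj j (single i x) = 0
  norm_le_mul_norm_of_injOn : ∀ {x y : Z} {σ : ι → ι}, Set.InjOn σ {j | proj j y ≠ 0} →
    ∀ {K : ℝ}, 0 ≤ K → (∀ j, ‖proj j y‖ ≤ K * ‖proj (σ j) x‖) → ‖y‖ ≤ K * ‖x‖

open Classical in
variable (𝕜 E p) in
/-- The coordinate inclusions and projections of `lpDirectSum 𝕜 E p`. -/
noncomputable def lpDirectSum.directSumStructure :
    DirectSumStructure 𝕜 E (lpDirectSum 𝕜 E p) where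
  single i := (lp.singleContinuousLinearMap 𝕜 E p i).codRestrict _ (single_mem_lpDirectSum i)
  proj i := (lp.evalCLM 𝕜 E p i).comp (lpDirectSum 𝕜 E p).subtypeL
  norm_single_apply_le i x := (lp.norm_single (zero_lt_one.trans_le hp.out) i x).le
  norm_proj_apply_le i x := lp.norm_apply_le_norm (zero_lt_one.trans_le hp.out).ne' x.1 i
  proj_single_self i x := lp.single_apply_self p i x
  proj_single_of_ne h x := lp.single_apply_ne p _ x h
  norm_le_mul_norm_of_injOn hσ _ hK h := lp_norm_le_mul_norm_of_injOn hσ hK h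

end DirectSumCoordinates

section NullSums

open Filter

variable {𝕜 : Type*} [RCLike 𝕜] {Γ : Type*} {X : Type*} [NormedAddCommGroup X] [NormedSpace 𝕜 X]
  {u : Γ → X} {K : ℝ}

theorem summable_smul_of_tendsto_zero [CompleteSpace X]
    (hu : ∀ (F : Finset Γ) (c : Γ → 𝕜) (C : ℝ), 0 ≤ C → (∀ t ∈ F, ‖c t‖ ≤ C) →
      ‖∑ t ∈ F, c t • u t‖ ≤ K * C)
    {c : Γ → 𝕜} (hc : Tendsto (fun t => ‖c t‖) cofinite (𝓝 0)) : Summable fun t => c t • u t := by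
  have hK : 0 ≤ K := by simpa using hu ∅ 0 1 zero_le_one (by simp)
  refine summable_iff_vanishing_norm.2 fun ε hε => ?_
  have hδ : 0 < ε / (K + 1) := by positivity
  have hfin : {t | ¬ ‖c t‖ < ε / (K + 1)}.Finite :=
    eventually_cofinite.1 (hc.eventually (gt_mem_nhds hδ))
  refine ⟨hfin.toFinset, fun F hF => (hu F c _ hδ.le fun t ht => ?_).trans_lt ?_⟩
  · by_contra hct
    exact Finset.disjoint_left.1 hF ht (hfin.mem_toFinset.2 fun h => hct h.le)
  · rw [mul_div_assoc', div_lt_iff₀ (by positivity)]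
    linarith

theorem exists_clm_cZero_hasSum [CompleteSpace X]
    (hu : ∀ (F : Finset Γ) (c : Γ → 𝕜) (C : ℝ), 0 ≤ C → (∀ t ∈ F, ‖c t‖ ≤ C) →
      ‖∑ t ∈ F, c t • u t‖ ≤ K * C) :
    ∃ Φ : cZero 𝕜 Γ →L[𝕜] X, ∀ c, HasSum (fun t => c.1 t • u t) (Φ c) := by
  have hs (c : cZero 𝕜 Γ) : Summable fun t => c.1 t • u t :=
    summable_smul_of_tendsto_zero hu (c.2 rfl)
  let Φ : cZero 𝕜 Γ →ₗ[𝕜] X :=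
    { toFun := fun c => ∑' t, c.1 t • u t
      map_add' := fun c c' => by
        rw [← (hs c).tsum_add (hs c')]
        exact tsum_congr fun t => add_smul _ _ _
      map_smul' := fun k c => by
        rw [RingHom.id_apply, ← (hs c).tsum_const_smul k]
        exact tsum_congr fun t => smul_assoc k (c.1 t) (u t) }
  refine ⟨Φ.mkContinuous K fun c => ?_, fun c => (hs c).hasSum⟩
  refine le_of_tendsto (hs c).hasSum.norm (.of_forall fun F => ?_)
  exact hu F _ _ (norm_nonneg c) fun t _ => lp.norm_apply_le_norm ENNReal.top_ne_zero c.1 t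

end NullSums

section Embeddings

variable {𝕜 : Type*} [RCLike 𝕜] {C X : Type*} [NormedAddCommGroup C] [NormedSpace 𝕜 C]
  [NormedAddCommGroup X] [NormedSpace 𝕜 X]

theorem isomorphicallyEmbeds_compactByApproximable_of_le_norm_sub
    (Ψ : C →L[𝕜] X →L[𝕜] X) (hΨ : ∀ c, IsCompactOperator (Ψ c)) {r : ℝ} (hr : 0 < r)
    (hle : ∀ c, ∀ S ∈ approximableOperators 𝕜 X X, r * ‖c‖ ≤ ‖Ψ c - S‖) :
    IsomorphicallyEmbeds 𝕜 C (CompactByApproximable 𝕜 X) := by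
  let A := (approximableOperators 𝕜 X X).submoduleOf (compactOperators 𝕜 X X)
  let Ψ' : C →ₗ[𝕜] compactOperators 𝕜 X X := Ψ.toLinearMap.codRestrict _ hΨ
  let Φ : C →L[𝕜] CompactByApproximable 𝕜 X :=
    LinearMap.mkContinuous (A.mkQ ∘ₗ Ψ') ‖Ψ‖ fun c =>
      (Submodule.Quotient.norm_mk_le A (Ψ' c)).trans (Ψ.le_opNorm c)
  refine ⟨Φ, r, hr, fun c => le_of_forall_pos_le_add fun ε hε => ?_⟩
  obtain ⟨T, hTΦ, hT⟩ : ∃ T : compactOperators 𝕜 X X, A.mkQ T = Φ c ∧ ‖T‖ < ‖Φ c‖ + ε :=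
    Submodule.Quotient.norm_mk_lt (S := A) (Φ c) hε
  have hmem : Ψ c - T ∈ approximableOperators 𝕜 X X :=
    (Submodule.Quotient.eq A (x := Ψ' c)).1 hTΦ.symm
  calc r * ‖c‖ ≤ ‖Ψ c - (Ψ c - T)‖ := hle c _ hmem
    _ = ‖T‖ := by rw [sub_sub_cancel, Submodule.coe_norm]
    _ ≤ ‖Φ c‖ + ε := hT.le

theorem IsomorphicallyEmbeds.not_separableSpace {Γ : Type*} [Uncountable Γ]
    (h : IsomorphicallyEmbeds 𝕜 C X) {e : Γ → C} (he : ∀ s t, s ≠ t → 1 ≤ ‖e s - e t‖) :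
    ¬ TopologicalSpace.SeparableSpace X := by
  intro hsep
  obtain ⟨Φ, c, hc, hΦ⟩ := h
  have hdisj : Pairwise (Function.onFun Disjoint fun t => Metric.ball (Φ (e t)) (c / 2)) := by
    refine fun s t hst => Metric.ball_disjoint_ball ?_
    rw [add_halves, dist_eq_norm, ← map_sub]
    exact (le_mul_of_one_le_right hc.le (he s t hst)).trans (hΦ _)
  have : Countable Γ := hdisj.countable_of_isOpen_disjoint (fun t => Metric.isOpen_ball)
    fun t => ⟨_, Metric.mem_ball_self (half_pos hc)⟩
  exact not_countable this

end Embeddings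

section SummandOperators

namespace DirectSumStructure

variable {𝕜 : Type*} [RCLike 𝕜] {ι : Type*} {E : ι → Type*}
  [∀ i, NormedAddCommGroup (E i)] [∀ i, NormedSpace 𝕜 (E i)] {Z : Type*} [NormedAddCommGroup Z]
  [NormedSpace 𝕜 Z] (D : DirectSumStructure 𝕜 E Z)

theorem norm_single_le (i : ι) : ‖D.single i‖ ≤ 1 :=
  ContinuousLinearMap.opNorm_le_bound _ zero_le_one fun x => by
    simpa using D.norm_single_apply_le i x

theorem norm_proj_le (i : ι) : ‖D.proj i‖ ≤ 1 :=
  ContinuousLinearMap.opNorm_le_bound _ zero_le_one fun x => by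
    simpa using D.norm_proj_apply_le i x

theorem norm_le_norm_single_sub {i j : ι} (h : i ≠ j) (x : E i) (y : E j) :
    ‖x‖ ≤ ‖D.single i x - D.single j y‖ := by
  simpa only [map_sub, D.proj_single_self, D.proj_single_of_ne h, sub_zero] using
    D.norm_proj_apply_le i (D.single i x - D.single j y)

theorem norm_proj_comp_comp_single_le (T : Z →L[𝕜] Z) (i j : ι) :
    ‖(D.proj j).comp (T.comp (D.single i))‖ ≤ ‖T‖ := by
  refine ContinuousLinearMap.opNorm_le_bound _ (norm_nonneg T) fun x => ?_
  calc ‖D.proj j (T (D.single i x))‖ ≤ ‖T (D.single i x)‖ := D.norm_proj_apply_le j _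
    _ ≤ ‖T‖ * ‖D.single i x‖ := T.le_opNorm _
    _ ≤ ‖T‖ * ‖x‖ := by gcongr; exact D.norm_single_apply_le i x

/-- The operator on a direct sum that maps its `i`-th summand to its `j`-th summand by `R` and
vanishes on the other summands. -/
noncomputable def summandOp {i j : ι} (R : E i →L[𝕜] E j) : Z →L[𝕜] Z :=
  (D.single j).comp (R.comp (D.proj i))

theorem proj_summandOp_self {i j : ι} (R : E i →L[𝕜] E j) (x : Z) :
    D.proj j (D.summandOp R x) = R (D.proj i x) :=
  D.proj_single_self j _

theorem proj_summandOp_of_ne {i j k : ι} (h : k ≠ j) (R : E i →L[𝕜] E j) (x : Z) :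
    D.proj k (D.summandOp R x) = 0 :=
  D.proj_single_of_ne h _

variable {Γ : Type*} {a b : Γ → ι} {R : ∀ t, E (a t) →L[𝕜] E (b t)}

theorem proj_sum_smul_summandOp_of_notMem_range {F : Finset Γ} {c : Γ → 𝕜} {j : ι}
    (hj : j ∉ Set.range b) (x : Z) :
    D.proj j ((∑ t ∈ F, c t • D.summandOp (R t)) x) = 0 := by
  simp only [sum_apply, map_sum, smul_apply, map_smul]
  refine Finset.sum_eq_zero fun t _ => ?_
  rw [D.proj_summandOp_of_ne (fun h => hj ⟨t, h.symm⟩), smul_zero]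

theorem norm_proj_sum_smul_summandOp_le (hb : Function.Injective b) {K : ℝ} (hK : 0 ≤ K)
    (hR : ∀ t, ‖R t‖ ≤ K) {F : Finset Γ} {c : Γ → 𝕜} {C : ℝ} (hC : 0 ≤ C)
    (hc : ∀ t ∈ F, ‖c t‖ ≤ C) (r : Γ) (x : Z) :
    ‖D.proj (b r) ((∑ t ∈ F, c t • D.summandOp (R t)) x)‖ ≤ K * C * ‖D.proj (a r) x‖ := by
  simp only [sum_apply, map_sum, smul_apply, map_smul]
  have eq_zero_of_ne (t : Γ) (htr : t ≠ r) :
      c t • D.proj (b r) (D.summandOp (R t) x) = 0 := by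
    rw [D.proj_summandOp_of_ne (hb.ne htr.symm), smul_zero]
  by_cases hr : r ∈ F
  · rw [Finset.sum_eq_single_of_mem r hr fun t _ => eq_zero_of_ne t, D.proj_summandOp_self,
      norm_smul, mul_comm K C, mul_assoc]
    exact mul_le_mul (hc r hr) ((R r).le_of_opNorm_le (hR r) _) (norm_nonneg _) hC
  · rw [Finset.sum_eq_zero fun t ht => eq_zero_of_ne t (ne_of_mem_of_not_mem ht hr), norm_zero]
    positivity

theorem norm_sum_smul_summandOp_le (ha : Function.Injective a) (hb : Function.Injective b)
    {K : ℝ} (hK : 0 ≤ K) (hR : ∀ t, ‖R t‖ ≤ K) (F : Finset Γ) (c : Γ → 𝕜) (C : ℝ) (hC : 0 ≤ C)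
    (hc : ∀ t ∈ F, ‖c t‖ ≤ C) : ‖∑ t ∈ F, c t • D.summandOp (R t)‖ ≤ K * C := by
  refine ContinuousLinearMap.opNorm_le_bound _ (by positivity) fun x => ?_
  let σ : ι → ι := Function.extend b a id
  have hσ (r : Γ) : σ (b r) = a r := hb.extend_apply a id r
  refine D.norm_le_mul_norm_of_injOn (σ := σ) (fun i hi j hj hij => ?_) (by positivity)
    fun j => ?_
  · obtain ⟨r, rfl⟩ := not_imp_comm.1 (D.proj_sum_smul_summandOp_of_notMem_range · x) hi
    obtain ⟨t, rfl⟩ := not_imp_comm.1 (D.proj_sum_smul_summandOp_of_notMem_range · x) hj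
    rw [hσ, hσ] at hij
    rw [ha hij]
  · by_cases hj : j ∈ Set.range b
    · obtain ⟨r, rfl⟩ := hj
      rw [hσ]
      exact D.norm_proj_sum_smul_summandOp_le hb hK hR hC hc r x
    · rw [D.proj_sum_smul_summandOp_of_notMem_range hj, norm_zero]
      positivity

variable {D} {c : Γ → 𝕜} {T : Z →L[𝕜] Z}

theorem isCompactOperator_of_hasSum_smul_summandOp [CompleteSpace Z]
    (hR : ∀ t, IsCompactOperator (R t)) (hT : HasSum (fun t => c t • D.summandOp (R t)) T) :
    IsCompactOperator T := by
  have hcl : IsClosed (compactOperators 𝕜 Z Z : Set (Z →L[𝕜] Z)) :=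
    isClosed_setOfPred_isCompactOperator
  refine hcl.mem_of_tendsto hT
    (.of_forall fun s => Submodule.sum_mem _ fun t _ => Submodule.smul_mem _ _ ?_)
  exact ((hR t).comp_clm (D.proj (a t))).clm_comp (D.single (b t))

theorem proj_comp_comp_single_of_hasSum (hb : Function.Injective b)
    (hT : HasSum (fun t => c t • D.summandOp (R t)) T) (t : Γ) :
    (D.proj (b t)).comp (T.comp (D.single (a t))) = c t • R t := by
  ext x
  let coord : (Z →L[𝕜] Z) →L[𝕜] E (b t) :=
    (D.proj (b t)).comp (.apply 𝕜 _ (D.single (a t) x))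
  have coord_smul (r : Γ) : coord (c r • D.summandOp (R r)) =
      c r • D.proj (b t) (D.summandOp (R r) (D.single (a t) x)) :=
    map_smul coord _ _
  have hsingle := hasSum_single (f := fun r => coord (c r • D.summandOp (R r))) t fun r hr => by
    rw [coord_smul, D.proj_summandOp_of_ne (hb.ne hr.symm), smul_zero]
  refine ((coord.hasSum hT).unique hsingle).trans ?_
  rw [coord_smul, D.proj_summandOp_self, D.proj_single_self]
  rfl

theorem norm_coeff_le_norm_sub_of_hasSum (hb : Function.Injective b)
    (hT : HasSum (fun t => c t • D.summandOp (R t)) T) (t : Γ)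
    (hR : ∀ S ∈ approximableOperators 𝕜 (E (a t)) (E (b t)), 1 ≤ ‖R t - S‖)
    {S : Z →L[𝕜] Z} (hS : S ∈ approximableOperators 𝕜 Z Z) : ‖c t‖ ≤ ‖T - S‖ := by
  rcases eq_or_ne (c t) 0 with hct | hct
  · rw [hct, norm_zero]
    exact norm_nonneg (T - S)
  let S' := (D.proj (b t)).comp (S.comp (D.single (a t)))
  have hS' : S' ∈ approximableOperators 𝕜 (E (a t)) (E (b t)) :=
    clm_comp_mem_approximableOperators _ (comp_clm_mem_approximableOperators hS _)
  calc ‖c t‖ ≤ ‖c t‖ * ‖R t - (c t)⁻¹ • S'‖ :=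
        le_mul_of_one_le_right (norm_nonneg _) (hR _ (Submodule.smul_mem _ _ hS'))
    _ = ‖c t • R t - S'‖ := by rw [← norm_smul, smul_sub, smul_inv_smul₀ hct]
    _ = ‖(D.proj (b t)).comp ((T - S).comp (D.single (a t)))‖ := by
        rw [← proj_comp_comp_single_of_hasSum hb hT t, ContinuousLinearMap.sub_comp,
          ContinuousLinearMap.comp_sub]
    _ ≤ ‖T - S‖ := D.norm_proj_comp_comp_single_le _ _ _

theorem isomorphicallyEmbeds_cZero_compactByApproximable [CompleteSpace Z]
    (D : DirectSumStructure 𝕜 E Z) (ha : Function.Injective a) (hb : Function.Injective b) {K : ℝ}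
    (hK : 0 ≤ K) (hR : ∀ t, IsCompactOperator (R t) ∧ ‖R t‖ ≤ K ∧
      ∀ S ∈ approximableOperators 𝕜 (E (a t)) (E (b t)), 1 ≤ ‖R t - S‖) :
    IsomorphicallyEmbeds 𝕜 (cZero 𝕜 Γ) (CompactByApproximable 𝕜 Z) := by
  obtain ⟨Ψ, hΨ⟩ := exists_clm_cZero_hasSum (𝕜 := 𝕜) (u := fun t => D.summandOp (R t))
    (D.norm_sum_smul_summandOp_le ha hb hK fun t => (hR t).2.1)
  refine isomorphicallyEmbeds_compactByApproximable_of_le_norm_sub Ψ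
    (fun c => isCompactOperator_of_hasSum_smul_summandOp (fun t => (hR t).1) (hΨ c)) one_pos
    fun c S hS => ?_
  rw [one_mul]
  exact lp.norm_le_of_forall_le (norm_nonneg (Ψ c - S)) fun t =>
    norm_coeff_le_norm_sub_of_hasSum hb (hΨ c) t (hR t).2.2 hS

end DirectSumStructure

end SummandOperators

section JohnsonSpaces

theorem exists_injective_section_of_infinite_fibers {s : ℕ → ℕ} (hs : ∀ n, {m | s m = n}.Infinite)
    (k : ℕ → ℕ) : ∃ m : ℕ → ℕ, Function.Injective m ∧ ∀ n, s (m n) = k n := by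
  choose g hg hgt using fun n N => (hs n).exists_gt N
  let m : ℕ → ℕ := fun n => Nat.rec (g (k 0) 0) (fun i r => g (k (i + 1)) r) n
  refine ⟨m, (strictMono_nat_of_lt_succ fun n => hgt (k (n + 1)) (m n)).injective, fun n => ?_⟩
  cases n with
  | zero => exact hg (k 0) 0
  | succ n => exact hg (k (n + 1)) (m n)

variable {𝕜 : Type u} [RCLike 𝕜]

theorem exists_clm_comp_eq_id_of_banachMazurDist_lt {E F : Type*} [NormedAddCommGroup E]
    [NormedSpace 𝕜 E] [NormedAddCommGroup F] [NormedSpace 𝕜 F] [Nontrivial F] {K : ℝ}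
    (h : banachMazurDist 𝕜 E F < ENNReal.ofReal K) :
    ∃ (J : F →L[𝕜] E) (P : E →L[𝕜] F), ‖J‖ ≤ 1 ∧ ‖P‖ ≤ K ∧ ∀ y, P (J y) = y := by
  obtain ⟨T, hT⟩ := iInf_lt_iff.1 h
  have hTK := (ENNReal.ofReal_lt_ofReal_iff'.1 hT).1
  set r := ‖(T.symm : F →L[𝕜] E)‖
  have hr : 0 < r := T.symm.norm_pos
  have hrn : ‖(r : 𝕜)‖ = r := RCLike.norm_of_nonneg hr.le
  refine ⟨(r : 𝕜)⁻¹ • (T.symm : F →L[𝕜] E), (r : 𝕜) • (T : E →L[𝕜] F), ?_, ?_, fun y => ?_⟩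
  · rw [norm_smul, norm_inv, hrn, inv_mul_cancel₀ hr.ne']
  · rw [norm_smul, hrn, mul_comm]
    exact hTK.le
  · have hr0 : (r : 𝕜) ≠ 0 := RCLike.ofReal_ne_zero.2 hr.ne'
    change (r : 𝕜) • T ((r : 𝕜)⁻¹ • T.symm y) = y
    rw [map_smul, T.apply_symm_apply, smul_inv_smul₀ hr0]

theorem DirectSumStructure.nonempty_blockSystem {ι : Type*} {G : ι → Type*}
    [∀ i, NormedAddCommGroup (G i)] [∀ i, NormedSpace 𝕜 (G i)] {Y : Type*} [NormedAddCommGroup Y]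
    [NormedSpace 𝕜 Y] (D : DirectSumStructure 𝕜 G Y) {Ω : ℕ → Type*} [∀ n, Fintype (Ω n)]
    [∀ n, Nonempty (Ω n)] {m : ℕ → ι} (hm : Function.Injective m) {K : ℝ}
    (h : ∀ n, banachMazurDist 𝕜 (G (m n)) (Ω n → 𝕜) < ENNReal.ofReal K) :
    Nonempty (BlockSystem 𝕜 Ω Y K) := by
  choose J P hJ hP hPJ using fun n => exists_clm_comp_eq_id_of_banachMazurDist_lt (h n)
  exact ⟨{
    incl := fun n => (D.single (m n)).comp (J n)
    proj := fun n => (P n).comp (D.proj (m n))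
    norm_incl_le := fun n => ((D.single (m n)).opNorm_comp_le _).trans
      (mul_le_one₀ (D.norm_single_le _) (norm_nonneg _) (hJ n))
    norm_proj_le := fun n => ((P n).opNorm_comp_le _).trans
      ((mul_le_of_le_one_right (norm_nonneg _) (D.norm_proj_le _)).trans (hP n))
    proj_incl := fun n f =>
      (congrArg (P n) (D.proj_single_self (m n) (J n f))).trans (hPJ n f)
    proj_incl_of_ne := fun {i j} hij f =>
      (congrArg (P i) (D.proj_single_of_ne (hm.ne hij) (J j f))).trans (map_zero (P i)) }⟩

variable {E : ℕ → Type v} [∀ n, NormedAddCommGroup (E n)] [∀ n, NormedSpace 𝕜 (E n)]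

theorem JohnsonSpace.nonempty_blockSystem {K : ℝ} {Ω : ℕ → Type*} [∀ n, Fintype (Ω n)]
    [∀ n, Nonempty (Ω n)] (hE : ∀ n, ∃ k, banachMazurDist 𝕜 (E k) (Ω n → 𝕜) < ENNReal.ofReal K)
    {s : ℕ → ℕ} (hs : ∀ n, {m | s m = n}.Infinite) (p : ℝ≥0∞) [Fact (1 ≤ p)] :
    Nonempty (BlockSystem 𝕜 Ω (JohnsonSpace 𝕜 E s p) K) := by
  choose k hk using hE
  obtain ⟨m, hm, hmk⟩ := exists_injective_section_of_infinite_fibers hs k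
  let D : DirectSumStructure 𝕜 (fun m => E (s m)) (JohnsonSpace 𝕜 E s p) :=
    lpDirectSum.directSumStructure 𝕜 _ p
  exact D.nonempty_blockSystem hm fun n => (hmk n).symm ▸ hk n

instance JohnsonSpace.completeSpace [∀ n, CompleteSpace (E n)] (s : ℕ → ℕ) (p : ℝ≥0∞)
    [Fact (1 ≤ p)] : CompleteSpace (JohnsonSpace 𝕜 E s p) :=
  completeSpace_lpDirectSum (𝕜 := 𝕜) (E := fun m => E (s m)) (p := p)

instance FigielJohnsonSpace.completeSpace [∀ n, CompleteSpace (E n)] (s : ℕ → ℕ) (p : ℝ≥0∞)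
    [Fact (1 ≤ p)] : CompleteSpace (FigielJohnsonSpace 𝕜 E s p) :=
  have (W : ClosedInfDimSubspace 𝕜 (JohnsonSpace 𝕜 E s p)) : CompleteSpace W.1 :=
    W.2.1.completeSpace_coe
  completeSpace_lpDirectSum (𝕜 := 𝕜)
    (E := fun W : ClosedInfDimSubspace 𝕜 (JohnsonSpace 𝕜 E s p) => W.1) (p := p)

theorem theorem4p5_general [∀ n, CompleteSpace (E n)] {K : ℝ}
    (hE : ∀ (α : Type) [Fintype α] [Nonempty α],
      ∃ n, banachMazurDist 𝕜 (E n) (α → 𝕜) < ENNReal.ofReal K)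
    {s : ℕ → ℕ} (hs : ∀ n, {m | s m = n}.Infinite) (p : ℝ≥0∞) [Fact (1 ≤ p)] :
    IsomorphicallyEmbeds 𝕜 (cZero 𝕜 ℝ)
        (CompactByApproximable 𝕜 (FigielJohnsonSpace 𝕜 E s p)) ∧
      ¬ TopologicalSpace.SeparableSpace
        (CompactByApproximable 𝕜 (FigielJohnsonSpace 𝕜 E s p)) := by
  obtain ⟨B⟩ := JohnsonSpace.nonempty_blockSystem (fun n => hE (BlockPoint n)) hs p
  obtain ⟨V, W, hV, hW, T, hTc, hTA⟩ :=
    B.exists_closed_subspaces_compact_notMem_approximableOperators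
  obtain ⟨a, b, R, ha, hb, hR⟩ :=
    exists_injective_compact_one_le_norm_sub_approximable hV hW hTc hTA
  let D : DirectSumStructure 𝕜 (fun W : ClosedInfDimSubspace 𝕜 (JohnsonSpace 𝕜 E s p) => W.1)
    (FigielJohnsonSpace 𝕜 E s p) := lpDirectSum.directSumStructure 𝕜 _ p
  have hemb := D.isomorphicallyEmbeds_cZero_compactByApproximable ha hb zero_le_three hR
  refine ⟨hemb, hemb.not_separableSpace
    (e := fun t => (lpDirectSum.directSumStructure 𝕜 (fun _ : ℝ => 𝕜) ∞).single t 1)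
    fun t r htr => ?_⟩
  exact norm_one.symm.trans_le (DirectSumStructure.norm_le_norm_single_sub _ htr 1 1)

end JohnsonSpaces

theorem theorem4p5 {𝕜 : Type u} [RCLike 𝕜] :
    ∃ Γ : Type, Uncountable Γ ∧
      ∀ (E : ℕ → Type v) [∀ n, NormedAddCommGroup (E n)] [∀ n, NormedSpace 𝕜 (E n)]
        [∀ n, FiniteDimensional 𝕜 (E n)],
        IsBanachMazurDense 𝕜 E →
        ∀ s : ℕ → ℕ, (∀ n, {m | s m = n}.Infinite) →
        ∀ (p : ℝ≥0∞) [Fact (1 ≤ p)],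
          IsomorphicallyEmbeds 𝕜 (cZero 𝕜 Γ)
            (CompactByApproximable 𝕜 (FigielJohnsonSpace 𝕜 E s p)) ∧
          ¬ TopologicalSpace.SeparableSpace
            (CompactByApproximable 𝕜 (FigielJohnsonSpace 𝕜 E s p)) := by
  refine ⟨ℝ, inferInstance, fun E _ _ _ hE s hs p _ => ?_⟩
  have (n : ℕ) : CompleteSpace (E n) := FiniteDimensional.complete 𝕜 (E n)
  exact theorem4p5_general (K := 2) (fun α _ _ => hE (α → 𝕜) _ (by norm_num)) hs p
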